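/- Let $\zeta$ be the Riemann zeta-function. Let $0<\gamma_1\le\gamma_2\le\cdots$ be the ordinates (imaginary parts) of the zeros of $\zeta$ in the upper half-plane, listed in nondecreasing order, where the ordinate of a zero of multiplicity $m$ is listed $m$ times. Write $\rho'=\beta'+i\gamma'$ for the zeros of the derivative $\zeta'$. Assume the Riemann Hypothesis, and assume that $$\liminf_{\gamma'\to\infty}\ \left(\beta'-\tfrac12\right)(\log\gamma')(\log\log\gamma')^2=0,$$ where the lower limit is taken over the zeros $\rho'=\beta'+i\gamma'$ of $\zeta'$ as $\gamma'\to\infty$. Then $$\liminf_{n\to\infty}\ (\gamma_{n+1}-\gamma_n)\log\gamma_n=0.$$ -/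

import Mathlib

open Filter Topology

noncomputable section

/-- `N(T)`: the number of zeros `ρ = β + iγ` of `ζ` with `0 < γ ≤ T`, counted with multiplicity.
All trivial zeros are real, so the zeros in the upper half-plane are all non-trivial. -/
def zetaZeroCount (T : ℝ) : ℕ :=
  ∑ᶠ ρ ∈ {ρ : ℂ | riemannZeta ρ = 0 ∧ 0 < ρ.im ∧ ρ.im ≤ T}, analyticOrderNatAt riemannZeta ρ

/-- `γ_n` for `n ≥ 1`: the `n`-th term of the nondecreasing sequence `0 < γ₁ ≤ γ₂ ≤ …` of the
ordinates of the zeros of `ζ` in the upper half-plane, the ordinate of a zero of multiplicity `m`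
being repeated `m` times. It is the least `T` with `N(T) ≥ n`. (`γ_0` has no meaning.) -/
def zetaOrdinate (n : ℕ) : ℝ :=
  sInf {T : ℝ | n ≤ zetaZeroCount T}

/-- The filter `γ' → ∞` on the zeros `ρ' = β' + iγ'` of `ζ'`. -/
def zetaDerivZerosAtTop : Filter ℂ :=
  comap Complex.im atTop ⊓ 𝓟 {ρ' : ℂ | deriv riemannZeta ρ' = 0}

end

/-! The argument is by contraposition. Suppose the normalised gaps are eventually at least some `c >
0`, and write `L = log t`. Then the zeros of ζ near height `t` are simple and, by RH, lie on the
critical line with mutual distance at least `c/(2L)`. Landau's lemma (`logDeriv_eq_sum_add`,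
`exists_logDeriv_zeta_eq`) gives `ζ'/ζ(s) = ∑ 1/(s - z) + h(s)`, where `h` is `O(L)` and Lipschitz
with constant `O(L)`.

On the critical line every `1/(s - z)` is purely imaginary, while the functional equation and the
growth of the digamma function give `Re ζ'/ζ ≤ -L/8` (`exists_re_logDeriv_zeta_le`). So `Re h ≤
-L/8` on the line, and `Re h ≤ -L/16` close to it. At a zero `s` of ζ' with `δ = Re s - 1/2` small,
the sum equals `-h(s)`: its real part `δ ∑ |s - z|⁻²` is at least `L/16`, and its modulus is `O(L)`.

These facts conflict when `δ` is too small (`re_lower_bound_of_sum`). By the spacing, the zeros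
other than the nearest one `ρ` contribute `O(L log L)` to `∑ 1/|s - z|` and only a small part of the
real part. Hence `1/|s - ρ| = O(L log L)`, and `δ/|s - ρ|²` must still be of order `L`. This forces
`|δ| L (log L)² ≫ 1`, against the hypothesis. -/

/-! ### Counting zeros and their ordinates -/

lemma re_eq_half_of_zero (hRH : RiemannHypothesis) {ρ : ℂ} (h0 : riemannZeta ρ = 0)
    (him : 0 < ρ.im) : ρ.re = 1 / 2 := by
  apply hRH ρ h0
  · rintro ⟨n, rfl⟩
    have : (-2 * ((n : ℂ) + 1)).im = 0 := by simp
    linarith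
  · rintro rfl
    simp at him

lemma finite_zeros_im_le (hRH : RiemannHypothesis) (T : ℝ) :
    {ρ : ℂ | riemannZeta ρ = 0 ∧ 0 < ρ.im ∧ ρ.im ≤ T}.Finite := by
  have hK : IsCompact (Set.Icc (0 : ℝ) 1 ×ℂ Set.Icc 0 T) := isCompact_Icc.reProdIm isCompact_Icc
  refine hK.inter_riemannZetaZeros_finite.subset ?_
  rintro ρ ⟨h0, h1, h2⟩
  have h3 := re_eq_half_of_zero hRH h0 h1
  refine ⟨⟨?_, ?_⟩, h0⟩ <;> simp only [Set.mem_preimage, Set.mem_Icc] <;> constructor <;> linarith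

lemma ne_one_of_im_pos {ρ : ℂ} (h : 0 < ρ.im) : ρ ≠ 1 := by
  rintro rfl
  simp at h

lemma analyticAt_zeta_of_im_pos {ρ : ℂ} (h : 0 < ρ.im) : AnalyticAt ℂ riemannZeta ρ :=
  analyticOn_riemannZeta ρ (ne_one_of_im_pos h)

lemma zeta_order_ne_top {ρ : ℂ} (h : 0 < ρ.im) : analyticOrderAt riemannZeta ρ ≠ ⊤ := by
  have h2 : analyticOrderAt riemannZeta 2 ≠ ⊤ := by
    have : analyticOrderAt riemannZeta 2 = 0 :=
      analyticOrderAt_eq_zero.2 (Or.inr (riemannZeta_ne_zero_of_one_le_re (by simp)))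
    simp [this]
  exact analyticOn_riemannZeta.analyticOrderAt_ne_top_of_isPreconnected
    (isConnected_compl_singleton_of_one_lt_rank (by simp) 1).isPreconnected
    (by simp) (ne_one_of_im_pos h) h2

lemma one_le_zeta_order {ρ : ℂ} (h0 : riemannZeta ρ = 0) (h : 0 < ρ.im) :
    1 ≤ analyticOrderNatAt riemannZeta ρ := by
  have h1 : analyticOrderAt riemannZeta ρ ≠ 0 :=
    (analyticAt_zeta_of_im_pos h).analyticOrderAt_ne_zero.2 h0
  have h2 := Nat.cast_analyticOrderNatAt (zeta_order_ne_top h)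
  rw [← h2] at h1
  exact Nat.one_le_iff_ne_zero.2 (by exact_mod_cast h1)

lemma two_le_zeta_order {ρ : ℂ} (h0 : riemannZeta ρ = 0) (h1 : deriv riemannZeta ρ = 0)
    (h : 0 < ρ.im) : 2 ≤ analyticOrderNatAt riemannZeta ρ := by
  have ha := analyticAt_zeta_of_im_pos h
  have h2 := Nat.cast_analyticOrderNatAt (zeta_order_ne_top h)
  have h3 := ha.analyticOrderAt_deriv_add_one
  simp only [h0, sub_zero] at h3
  have h4 : analyticOrderAt (deriv riemannZeta) ρ ≠ 0 := ha.deriv.analyticOrderAt_ne_zero.2 h1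
  have h5 : (1 : ℕ∞) ≤ analyticOrderAt (deriv riemannZeta) ρ := Order.one_le_iff_ne_zero.2 h4
  have h6 : (2 : ℕ∞) ≤ analyticOrderAt riemannZeta ρ := by
    rw [← h3, show (2 : ℕ∞) = 1 + 1 by norm_num]
    gcongr
  rw [← h2] at h6
  exact_mod_cast h6

lemma zetaZeroCount_eq_sum (hRH : RiemannHypothesis) (T : ℝ) :
    zetaZeroCount T =
      ∑ ρ ∈ (finite_zeros_im_le hRH T).toFinset, analyticOrderNatAt riemannZeta ρ := by
  rw [zetaZeroCount, finsum_mem_eq_finite_toFinset_sum _ (finite_zeros_im_le hRH T)]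

lemma zetaZeroCount_mono (hRH : RiemannHypothesis) : Monotone zetaZeroCount := by
  intro T T' h
  rw [zetaZeroCount_eq_sum hRH, zetaZeroCount_eq_sum hRH]
  refine Finset.sum_le_sum_of_subset fun ρ hρ => ?_
  simp only [Set.Finite.mem_toFinset, Set.mem_ofPred_eq] at hρ ⊢
  exact ⟨hρ.1, hρ.2.1, hρ.2.2.trans h⟩

/-- A lower bound for the jump of `N` at `ρ.im` is enough to show that the last indices up to
`N(ρ.im)` all have ordinate `ρ.im`. -/
lemma zetaZeroCount_add_order_le (hRH : RiemannHypothesis) {ρ : ℂ} (h0 : riemannZeta ρ = 0)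
    (h : 0 < ρ.im) {T : ℝ} (hT : T < ρ.im) :
    zetaZeroCount T + analyticOrderNatAt riemannZeta ρ ≤ zetaZeroCount ρ.im := by
  rw [zetaZeroCount_eq_sum hRH, zetaZeroCount_eq_sum hRH]
  have hn : ρ ∉ (finite_zeros_im_le hRH T).toFinset := by
    simp only [Set.Finite.mem_toFinset, Set.mem_ofPred_eq]
    intro h'
    linarith [h'.2.2]
  rw [add_comm, ← Finset.sum_insert hn]
  refine Finset.sum_le_sum_of_subset fun z hz => ?_
  simp only [Finset.mem_insert, Set.Finite.mem_toFinset, Set.mem_ofPred_eq] at hz ⊢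
  rcases hz with rfl | hz
  · exact ⟨h0, h, le_rfl⟩
  · exact ⟨hz.1, hz.2.1, hz.2.2.trans hT.le⟩

lemma zetaZeroCount_of_nonpos {T : ℝ} (hT : T ≤ 0) : zetaZeroCount T = 0 := by
  have : {ρ : ℂ | riemannZeta ρ = 0 ∧ 0 < ρ.im ∧ ρ.im ≤ T} = ∅ := by
    ext ρ
    simp only [Set.mem_ofPred_eq, Set.mem_empty_iff_false, iff_false]
    intro h
    linarith [h.2.1, h.2.2]
  rw [zetaZeroCount, this, finsum_mem_empty]

lemma pos_of_le_zetaZeroCount {n : ℕ} (hn : 1 ≤ n) {T : ℝ} (h : n ≤ zetaZeroCount T) : 0 < T := by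
  by_contra hT
  rw [zetaZeroCount_of_nonpos (not_lt.1 hT)] at h
  omega

lemma bddBelow_le_zetaZeroCount {n : ℕ} (hn : 1 ≤ n) :
    BddBelow {T : ℝ | n ≤ zetaZeroCount T} :=
  ⟨0, fun _ hT => (pos_of_le_zetaZeroCount hn hT).le⟩

lemma zetaOrdinate_le {n : ℕ} (hn : 1 ≤ n) {T : ℝ} (h : n ≤ zetaZeroCount T) :
    zetaOrdinate n ≤ T :=
  csInf_le (bddBelow_le_zetaZeroCount hn) h

lemma zetaOrdinate_eq {n : ℕ} (hn : 1 ≤ n) {γ : ℝ} (h : n ≤ zetaZeroCount γ)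
    (hlt : ∀ T < γ, zetaZeroCount T < n) : zetaOrdinate n = γ := by
  refine le_antisymm (zetaOrdinate_le hn h) (le_csInf ⟨γ, h⟩ fun T hT => ?_)
  by_contra hc
  exact absurd (hlt T (not_le.1 hc)) (not_lt.2 hT)

lemma zetaOrdinate_of_bounded {K n : ℕ} (hK : ∀ T, zetaZeroCount T ≤ K) (hn : K < n) :
    zetaOrdinate n = 0 := by
  have : {T : ℝ | n ≤ zetaZeroCount T} = ∅ := by
    ext T
    simp only [Set.mem_ofPred_eq, Set.mem_empty_iff_false, iff_false, not_le]
    exact (hK T).trans_lt hn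
  rw [zetaOrdinate, this, Real.sInf_empty]

lemma zetaOrdinate_le_succ (hub : ∀ K, ∃ T, K < zetaZeroCount T) {n : ℕ} (hn : 1 ≤ n) :
    zetaOrdinate n ≤ zetaOrdinate (n + 1) := by
  obtain ⟨T, hT⟩ := hub n
  exact csInf_le_csInf (bddBelow_le_zetaZeroCount hn) ⟨T, hT⟩ fun T hT => (Nat.le_succ n).trans hT

lemma le_zetaOrdinate (hRH : RiemannHypothesis) (hub : ∀ K, ∃ T, K < zetaZeroCount T) {n : ℕ}
    {T : ℝ} (h : zetaZeroCount T < n) : T ≤ zetaOrdinate n := by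
  obtain ⟨S, hS⟩ := hub n
  refine le_csInf ⟨S, hS.le⟩ fun S hS => ?_
  by_contra hc
  have := zetaZeroCount_mono hRH (not_le.1 hc).le
  exact absurd (hS.trans this) (by omega)

lemma eventually_gap_nonneg (hRH : RiemannHypothesis) :
    ∀ᶠ n : ℕ in atTop,
      0 ≤ (zetaOrdinate (n + 1) - zetaOrdinate n) * Real.log (zetaOrdinate n) := by
  by_cases hub : ∀ K, ∃ T, K < zetaZeroCount T
  · filter_upwards [eventually_gt_atTop (zetaZeroCount 1)] with n hn
    have h1 := zetaOrdinate_le_succ hub (by omega : 1 ≤ n)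
    exact mul_nonneg (by linarith) (Real.log_nonneg (le_zetaOrdinate hRH hub hn))
  -- If `N` were bounded, later ordinates would be `sInf ∅ = 0`, and the product would vanish.
  · push Not at hub
    obtain ⟨K, hK⟩ := hub
    filter_upwards [eventually_gt_atTop K] with n hn
    simp [zetaOrdinate_of_bounded hK hn]

/-- If the normalised gaps between consecutive ordinates stay away from zero, then the zeros high up
are simple and well spaced. -/
theorem zeros_simple_and_spaced (hRH : RiemannHypothesis) {c : ℝ} (hc : 0 < c)
    (h : ∀ᶠ n : ℕ in atTop,
      c ≤ (zetaOrdinate (n + 1) - zetaOrdinate n) * Real.log (zetaOrdinate n)) :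
    ∃ T₀ : ℝ, 1 ≤ T₀ ∧
      (∀ ρ : ℂ, riemannZeta ρ = 0 → T₀ ≤ ρ.im → deriv riemannZeta ρ ≠ 0) ∧
      ∀ ρ ρ' : ℂ, riemannZeta ρ = 0 → riemannZeta ρ' = 0 → T₀ ≤ ρ.im → ρ.im < ρ'.im →
        c ≤ (ρ'.im - ρ.im) * Real.log ρ.im := by
  obtain ⟨n₀, hn₀⟩ := eventually_atTop.1 h
  -- Bounded `N` would give the default ordinate 0 for large indices, hence gap 0, against `c > 0`.
  have hub : ∀ K, ∃ T, K < zetaZeroCount T := by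
    by_contra hb
    push Not at hb
    obtain ⟨K, hK⟩ := hb
    have := hn₀ (max n₀ (K + 1)) (le_max_left _ _)
    rw [zetaOrdinate_of_bounded hK (show K < max n₀ (K + 1) by omega)] at this
    simp at this
    linarith
  -- The margin keeps `N(ρ.im) - 1` at least `n₀` and positive, so the meaningless index 0 never
  -- occurs.
  obtain ⟨S, hS⟩ := hub (n₀ + 2)
  refine ⟨max 1 S, le_max_left _ _, fun ρ h0 hT h1 => ?_, fun ρ ρ' h0 h0' hT hlt => ?_⟩
  · have him : 0 < ρ.im := by linarith [le_max_left 1 S]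
    have hN := zetaZeroCount_mono hRH ((le_max_right 1 S).trans hT)
    have h2 := two_le_zeta_order h0 h1 him
    have e1 : zetaOrdinate (zetaZeroCount ρ.im) = ρ.im :=
      zetaOrdinate_eq (by omega) le_rfl fun T hT' => by
        have := zetaZeroCount_add_order_le hRH h0 him hT'
        omega
    -- A multiple zero makes two consecutive indices share an ordinate, so their gap is 0.
    have e2 : zetaOrdinate (zetaZeroCount ρ.im - 1) = ρ.im :=
      zetaOrdinate_eq (by omega) (by omega) fun T hT' => by
        have := zetaZeroCount_add_order_le hRH h0 him hT'
        omega
    have := hn₀ (zetaZeroCount ρ.im - 1) (by omega)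
    rw [Nat.sub_add_cancel (by omega), e1, e2] at this
    simp at this
    linarith
  · have him : 0 < ρ.im := by linarith [le_max_left 1 S]
    have hN := zetaZeroCount_mono hRH ((le_max_right 1 S).trans hT)
    have e1 : zetaOrdinate (zetaZeroCount ρ.im) = ρ.im :=
      zetaOrdinate_eq (by omega) le_rfl fun T hT' => by
        have := zetaZeroCount_add_order_le hRH h0 him hT'
        have := one_le_zeta_order h0 him
        omega
    have e2 : zetaOrdinate (zetaZeroCount ρ.im + 1) ≤ ρ'.im :=
      zetaOrdinate_le (by omega) (by
        have := zetaZeroCount_add_order_le hRH h0' (him.trans hlt) hlt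
        have := one_le_zeta_order h0' (him.trans hlt)
        omega)
    have h3 := hn₀ (zetaZeroCount ρ.im) (by omega)
    rw [e1] at h3
    refine h3.trans ?_
    gcongr
    exact Real.log_nonneg ((le_max_left 1 S).trans hT)

/-! ### Landau's lemma on the logarithmic derivative -/

/-- Dividing out finitely many zeros of a holomorphic function. -/
lemma exists_eq_prod_sub_mul {U : Set ℂ} (hU : IsOpen U) {f : ℂ → ℂ}
    (hf : DifferentiableOn ℂ f U) (Z : Finset ℂ) (hZ : ∀ z ∈ Z, z ∈ U ∧ f z = 0) :
    ∃ g : ℂ → ℂ, DifferentiableOn ℂ g U ∧ ∀ s ∈ U, f s = (∏ z ∈ Z, (s - z)) * g s := by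
  induction Z using Finset.induction_on with
  | empty => exact ⟨f, hf, fun s _ => by simp⟩
  | insert a Z ha ih =>
    obtain ⟨g, hg, hfg⟩ := ih fun z hz => hZ z (Finset.mem_insert_of_mem hz)
    obtain ⟨haU, hfa⟩ := hZ a (Finset.mem_insert_self a Z)
    have hga : g a = 0 := by
      have h1 := hfg a haU
      rw [hfa] at h1
      refine (mul_eq_zero.1 h1.symm).resolve_left (Finset.prod_ne_zero_iff.2 fun z hz => ?_)
      rw [sub_ne_zero]
      rintro rfl
      exact ha hz
    refine ⟨dslope g a, (Complex.differentiableOn_dslope (hU.mem_nhds haU)).2 hg, fun s hs => ?_⟩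
    have h2 := sub_smul_dslope g a s
    rw [hga, sub_zero, smul_eq_mul] at h2
    rw [hfg s hs, Finset.prod_insert ha, ← h2]
    ring

/-- A nonvanishing holomorphic function on a disc is the exponential of a holomorphic function. -/
lemma exists_eq_mul_exp {c : ℂ} {r : ℝ} (hr : 0 < r) {g : ℂ → ℂ}
    (hg : DifferentiableOn ℂ g (Metric.ball c r)) (hg0 : ∀ s ∈ Metric.ball c r, g s ≠ 0) :
    ∃ H : ℂ → ℂ, H c = 0 ∧ (∀ s ∈ Metric.ball c r, HasDerivAt H (logDeriv g s) s) ∧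
      ∀ s ∈ Metric.ball c r, g s = g c * Complex.exp (H s) := by
  have hd : DifferentiableOn ℂ (logDeriv g) (Metric.ball c r) :=
    (hg.deriv Metric.isOpen_ball).div hg hg0
  obtain ⟨H, hH0, hH⟩ := hd.isExactOn_ball.with_val_at c 0
  refine ⟨H, hH0, hH, fun s hs => ?_⟩
  have hgd : ∀ x ∈ Metric.ball c r, HasDerivAt g (deriv g x) x := fun x hx =>
    ((hg x hx).differentiableAt (Metric.isOpen_ball.mem_nhds hx)).hasDerivAt
  have hq : ∀ x ∈ Metric.ball c r, HasDerivAt (fun x => g x * Complex.exp (-H x)) 0 x := by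
    intro x hx
    have h1 := (hgd x hx).mul ((hH x hx).neg.cexp)
    refine HasDerivAt.congr_deriv (f := fun x => g x * Complex.exp (-H x)) h1 ?_
    have := hg0 x hx
    simp only [logDeriv_apply, Pi.neg_apply]
    field_simp
    ring
  have hconst := (convex_ball c r).is_const_of_fderivWithin_eq_zero (𝕜 := ℂ)
    (f := fun x => g x * Complex.exp (-H x))
    (fun x hx => (hq x hx).differentiableAt.differentiableWithinAt)
    (fun x hx => by
      rw [fderivWithin_of_isOpen Metric.isOpen_ball hx]
      ext
      simp [(hq x hx).deriv]) hs (Metric.mem_ball_self hr)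
  simp only [hH0, neg_zero, Complex.exp_zero, mul_one, Complex.exp_neg] at hconst
  rw [← hconst]
  field_simp [Complex.exp_ne_zero]

/-- A zero-free holomorphic function bounded on a disc by its value at the centre has bounded
logarithmic derivative, Lipschitz in smaller discs. -/
lemma logDeriv_bound {c : ℂ} {g : ℂ → ℂ} {B : ℝ} (hB : 0 < B)
    (hg : DifferentiableOn ℂ g (Metric.ball c 1.8)) (hg0 : ∀ s ∈ Metric.ball c 1.8, g s ≠ 0)
    (hb : ∀ s ∈ Metric.ball c 1.8, ‖g s‖ ≤ ‖g c‖ * Real.exp B) :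
    (∀ s ∈ Metric.closedBall c 1.6, ‖logDeriv g s‖ ≤ 20000 * B) ∧
    ∀ s ∈ Metric.closedBall c 1.6, ∀ s' ∈ Metric.closedBall c 1.6,
      ‖logDeriv g s - logDeriv g s'‖ ≤ 20000 * B * ‖s - s'‖ := by
  obtain ⟨H, hH0, hH, hexp⟩ := exists_eq_mul_exp (by norm_num) hg hg0
  have hc : c ∈ Metric.ball c (1.8 : ℝ) := Metric.mem_ball_self (by norm_num)
  have hre : ∀ s ∈ Metric.ball c (1.8 : ℝ), (H s).re ≤ B := by
    intro s hs
    have h1 := hb s hs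
    rw [hexp s hs, norm_mul, Complex.norm_exp] at h1
    exact Real.exp_le_exp.1 (le_of_mul_le_mul_left h1 (norm_pos_iff.2 (hg0 c hc)))
  have hbd : ∀ s, ‖s - c‖ ≤ 1.7 → ‖H s‖ ≤ 34 * B := by
    intro s hs
    have hmap : ∀ w ∈ Metric.ball (0 : ℂ) 1.8, c + w ∈ Metric.ball c (1.8 : ℝ) := by
      intro w hw
      simpa [dist_eq_norm] using hw
    -- The factor 34 is `2 · 1.7 / (1.8 - 1.7)`.
    have h1 := Complex.borelCaratheodory_zero (f := fun w => H (c + w)) (R := 1.8) (z := s - c)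
      hB (fun w hw => by
        have := (hH (c + w) (hmap w hw)).comp_const_add c w
        exact this.differentiableAt.differentiableWithinAt)
      (fun w hw => hre _ (hmap w hw)) (by norm_num)
      (by rw [mem_ball_zero_iff]; exact hs.trans_lt (by norm_num)) (by simpa using hH0)
    simp only [add_sub_cancel] at h1
    refine h1.trans ?_
    rw [div_le_iff₀ (by linarith)]
    nlinarith
  have hmem : ∀ s, ‖s - c‖ ≤ 1.75 → s ∈ Metric.ball c (1.8 : ℝ) := fun s hs => by
    rw [Metric.mem_ball, dist_eq_norm]
    exact hs.trans_lt (by norm_num)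
  -- Cauchy's estimate with radius 0.05 costs a factor 20. Applied to `H` and then to its derivative
  -- it gives `34 · 20 = 680` and `680 · 20 = 13600 ≤ 20000`.
  have hcauchy : ∀ (φ : ℂ → ℂ) (A : ℝ) (s : ℂ), ‖s - c‖ ≤ 1.65 →
      DifferentiableOn ℂ φ (Metric.ball c 1.8) →
      (∀ w, ‖w - s‖ ≤ 0.05 → ‖φ w‖ ≤ A) → ‖deriv φ s‖ ≤ 20 * A := by
    intro φ A s hs hφ hA
    rw [show 20 * A = A / 0.05 by ring]
    refine Complex.norm_deriv_le_of_forall_mem_sphere_norm_le (by norm_num)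
      (DifferentiableOn.diffContOnCl_ball (U := Metric.ball c 1.8) hφ fun w hw => ?_)
      fun w hw => hA w ?_
    · refine hmem w ?_
      rw [Metric.mem_closedBall, dist_eq_norm] at hw
      have := norm_sub_le_norm_sub_add_norm_sub w s c
      linarith
    · rw [mem_sphere_iff_norm] at hw
      exact hw.le
  have hHd : DifferentiableOn ℂ H (Metric.ball c 1.8) := fun s hs =>
    (hH s hs).differentiableAt.differentiableWithinAt
  have hd1 : ∀ s, ‖s - c‖ ≤ 1.65 → ‖logDeriv g s‖ ≤ 680 * B := by
    intro s hs
    have h1 := hcauchy H (34 * B) s hs hHd fun w hw => hbd w (by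
      have := norm_sub_le_norm_sub_add_norm_sub w s c
      linarith)
    rw [(hH s (hmem s (hs.trans (by norm_num)))).deriv] at h1
    linarith
  have hld : DifferentiableOn ℂ (logDeriv g) (Metric.ball c 1.8) :=
    (hg.deriv Metric.isOpen_ball).div hg hg0
  refine ⟨fun s hs => ?_, fun s hs s' hs' => ?_⟩
  · rw [Metric.mem_closedBall, dist_eq_norm] at hs
    linarith [hd1 s (hs.trans (by norm_num))]
  · refine (convex_closedBall c (1.6 : ℝ)).norm_image_sub_le_of_norm_deriv_le (𝕜 := ℂ)
      (fun x hx => ?_) (fun x hx => ?_) hs' hs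
    · rw [Metric.mem_closedBall, dist_eq_norm] at hx
      have := hmem x (hx.trans (by norm_num))
      exact (hld x this).differentiableAt (Metric.isOpen_ball.mem_nhds this)
    · rw [Metric.mem_closedBall, dist_eq_norm] at hx
      have h1 := hcauchy (logDeriv g) (680 * B) x (hx.trans (by norm_num)) hld fun w hw =>
        hd1 w (by
          have := norm_sub_le_norm_sub_add_norm_sub w x c
          linarith)
      linarith

/-- **Landau's lemma** for a function with simple zeros. -/
theorem logDeriv_eq_sum_add {c : ℂ} {f : ℂ → ℂ} {U : Set ℂ} (hU : IsOpen U)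
    (hUc : Metric.closedBall c 1.9 ⊆ U) (hf : DifferentiableOn ℂ f U) {M : ℝ} (hM : 0 < M)
    (hb : ∀ s ∈ Metric.closedBall c 1.9, ‖f s‖ ≤ ‖f c‖ * Real.exp M)
    (Z : Finset ℂ) (hZ : ∀ z, z ∈ Z ↔ z ∈ Metric.closedBall c 1.8 ∧ f z = 0)
    (hsimple : ∀ z ∈ Z, deriv f z ≠ 0) :
    ∃ h : ℂ → ℂ,
      (∀ s ∈ Metric.closedBall c 1.6, f s ≠ 0 → logDeriv f s = ∑ z ∈ Z, (s - z)⁻¹ + h s) ∧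
      (∀ s ∈ Metric.closedBall c 1.6, ‖h s‖ ≤ 20000 * (M + 3 * Z.card)) ∧
      ∀ s ∈ Metric.closedBall c 1.6, ∀ s' ∈ Metric.closedBall c 1.6,
        ‖h s - h s'‖ ≤ 20000 * (M + 3 * Z.card) * ‖s - s'‖ := by
  have hsub : ∀ {x : ℝ}, x ≤ 1.9 → Metric.closedBall c x ⊆ U := fun hx =>
    (Metric.closedBall_subset_closedBall hx).trans hUc
  have hZU : ∀ z ∈ Z, z ∈ U := fun z hz => hsub (by norm_num) ((hZ z).1 hz).1
  obtain ⟨g, hg, hfg⟩ := exists_eq_prod_sub_mul hU hf Z fun z hz => ⟨hZU z hz, ((hZ z).1 hz).2⟩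
  have hgat : ∀ s ∈ U, DifferentiableAt ℂ g s := fun s hs =>
    (hg s hs).differentiableAt (hU.mem_nhds hs)
  -- A zero of the quotient would lie in `Z` and be a multiple zero of `f`, which simplicity
  -- excludes.
  have hg0 : ∀ s ∈ Metric.closedBall c 1.8, g s ≠ 0 := by
    intro s hs hgs
    have hsU := hsub (by norm_num) hs
    have hsZ : s ∈ Z := (hZ s).2 ⟨hs, by rw [hfg s hsU, hgs, mul_zero]⟩
    have hP : DifferentiableAt ℂ (fun x => ∏ z ∈ Z, (x - z)) s := by fun_prop
    have h1 : HasDerivAt (fun x => (∏ z ∈ Z, (x - z)) * g x) 0 s := by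
      refine HasDerivAt.congr_deriv (f := fun x => (∏ z ∈ Z, (x - z)) * g x)
        (hP.hasDerivAt.mul (hgat s hsU).hasDerivAt) ?_
      rw [hgs, Finset.prod_eq_zero hsZ (sub_self s)]
      simp
    refine hsimple s hsZ ?_
    rw [← h1.deriv]
    refine Filter.EventuallyEq.deriv_eq ?_
    filter_upwards [hU.mem_nhds hsU] with x hx using hfg x hx
  have hfcU : f c = (∏ z ∈ Z, (c - z)) * g c :=
    hfg c (hUc (Metric.mem_closedBall_self (by norm_num)))
  have hprodc : ‖∏ z ∈ Z, (c - z)‖ ≤ 2 ^ Z.card := by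
    rw [norm_prod, ← Finset.prod_const]
    refine Finset.prod_le_prod (fun _ _ => norm_nonneg _) fun z hz => ?_
    have := ((hZ z).1 hz).1
    rw [Metric.mem_closedBall, dist_comm, dist_eq_norm] at this
    exact this.trans (by norm_num)
  -- On this circle `|s - z| ≥ 1/10`, while `|c - z| ≤ 2`. Each zero divided out therefore costs at
  -- most a factor `20 ≤ e³`; the maximum principle then carries the bound inwards.
  have hsphere : ∀ s ∈ Metric.sphere c (1.9 : ℝ),
      ‖g s‖ ≤ ‖g c‖ * Real.exp (M + 3 * Z.card) := by
    intro s hs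
    have hsc := Metric.sphere_subset_closedBall hs
    have hlow : (1 / 10 : ℝ) ^ Z.card ≤ ‖∏ z ∈ Z, (s - z)‖ := by
      rw [norm_prod, ← Finset.prod_const]
      refine Finset.prod_le_prod (fun _ _ => by norm_num) fun z hz => ?_
      have h1 := ((hZ z).1 hz).1
      rw [Metric.mem_closedBall, dist_eq_norm] at h1
      rw [mem_sphere_iff_norm] at hs
      have := norm_sub_le_norm_sub_add_norm_sub s z c
      norm_num at *
      linarith
    have h1 := hb s hsc
    rw [hfg s (hUc hsc), hfcU, norm_mul, norm_mul] at h1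
    have h20 : (20 : ℝ) ^ Z.card ≤ Real.exp (3 * Z.card) := by
      rw [mul_comm, Real.exp_nat_mul]
      gcongr
      have h27 := Real.exp_one_gt_d9
      rw [show (3 : ℝ) = (3 : ℕ) * 1 by norm_num, Real.exp_nat_mul]
      have : (2.718 : ℝ) ^ 3 ≤ Real.exp 1 ^ 3 := by gcongr; linarith
      norm_num at this ⊢
      linarith
    have h2 : (1 / 10 : ℝ) ^ Z.card * ‖g s‖ ≤ 2 ^ Z.card * ‖g c‖ * Real.exp M := by
      calc (1 / 10 : ℝ) ^ Z.card * ‖g s‖ ≤ _ := mul_le_mul_of_nonneg_right hlow (norm_nonneg _)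
        _ ≤ _ := h1
        _ ≤ _ := by gcongr
    have h3 : ‖g s‖ ≤ 20 ^ Z.card * ‖g c‖ * Real.exp M := by
      have h4 : (10 : ℝ) ^ Z.card * (1 / 10) ^ Z.card = 1 := by
        rw [← mul_pow]
        norm_num
      calc ‖g s‖ = 10 ^ Z.card * ((1 / 10) ^ Z.card * ‖g s‖) := by rw [← mul_assoc, h4, one_mul]
        _ ≤ 10 ^ Z.card * (2 ^ Z.card * ‖g c‖ * Real.exp M) := by gcongr
        _ = (10 * 2) ^ Z.card * ‖g c‖ * Real.exp M := by rw [mul_pow]; ring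
        _ = _ := by norm_num
    rw [Real.exp_add]
    calc ‖g s‖ ≤ 20 ^ Z.card * ‖g c‖ * Real.exp M := h3
      _ ≤ Real.exp (3 * Z.card) * ‖g c‖ * Real.exp M := by gcongr
      _ = _ := by ring
  have hgball : ∀ s ∈ Metric.ball c 1.8, ‖g s‖ ≤ ‖g c‖ * Real.exp (M + 3 * Z.card) := by
    intro s hs
    refine Complex.norm_le_of_forall_mem_frontier_norm_le (U := Metric.ball c (1.9 : ℝ))
      Metric.isBounded_ball (hg.diffContOnCl_ball hUc) (fun z hz => ?_) (subset_closure ?_)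
    · rw [frontier_ball _ (by norm_num)] at hz
      exact hsphere z hz
    · exact Metric.ball_subset_ball (by norm_num) hs
  obtain ⟨hl1, hl2⟩ := logDeriv_bound (B := M + 3 * Z.card) (by positivity)
    (hg.mono (Metric.ball_subset_closedBall.trans (hsub (by norm_num))))
    (fun s hs => hg0 s (Metric.ball_subset_closedBall hs)) hgball
  refine ⟨logDeriv g, fun s hs hfs => ?_, hl1, hl2⟩
  have hsU := hsub (by norm_num) hs
  have hne : ∀ z ∈ Z, s - z ≠ 0 := fun z hz h0 => by
    rw [sub_eq_zero] at h0
    exact hfs (h0 ▸ ((hZ z).1 hz).2)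
  have h1 : logDeriv f s = logDeriv (fun x => (∏ z ∈ Z, (x - z)) * g x) s := by
    have he : f =ᶠ[𝓝 s] fun x => (∏ z ∈ Z, (x - z)) * g x := by
      filter_upwards [hU.mem_nhds hsU] with x hx using hfg x hx
    rw [logDeriv_apply, logDeriv_apply, he.deriv_eq, he.eq_of_nhds]
  rw [h1, logDeriv_mul s (Finset.prod_ne_zero_iff.2 hne)
    (hg0 s (Metric.closedBall_subset_closedBall (by norm_num) hs)) (by fun_prop) (hgat s hsU)]
  congr 1
  have := logDeriv_prod (s := Z) (f := fun z x => x - z) (x := s) hne (fun z _ => by fun_prop)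
  rw [this]
  refine Finset.sum_congr rfl fun z _ => ?_
  rw [logDeriv_apply]
  simp

/-! ### Size of ζ in vertical strips -/

/-- The difference between a term of the zeta series and the matching integral. -/
noncomputable def zetaTermDiff (n : ℕ) (s : ℂ) : ℂ :=
  ((n : ℂ) + 1) ^ (-s) - (((n : ℂ) + 2) ^ (1 - s) - ((n : ℂ) + 1) ^ (1 - s)) / (1 - s)

lemma hasDerivAt_add_cpow {a u : ℝ} (h : 0 < a + u) (w : ℂ) :
    HasDerivAt (fun x : ℝ => ((a : ℂ) + x) ^ w) (w * ((a : ℂ) + u) ^ (w - 1)) u := by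
  have h1 : HasDerivAt (fun x : ℝ => (a : ℂ) + x) 1 u := by
    simpa using (Complex.ofRealCLM.hasDerivAt (x := u)).const_add (a : ℂ)
  have hs : (a : ℂ) + u ∈ Complex.slitPlane := by
    rw [← Complex.ofReal_add]
    exact Complex.ofReal_mem_slitPlane.2 h
  have h2 := (hasDerivAt_id ((a : ℂ) + u)).cpow_const (c := w) hs
  have h3 := HasDerivAt.comp u (h₂ := fun x : ℂ => id x ^ w) h2 h1
  refine HasDerivAt.congr_deriv (f := fun x : ℝ => ((a : ℂ) + x) ^ w) h3 ?_
  simp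

/-- The difference is the integral of `(n+1)^(-s) - x^(-s)` over `[n+1, n+2]`. The mean value
inequality is used twice: to bound the integrand, and to bound the increment of its primitive. -/
lemma norm_zetaTermDiff_le (n : ℕ) {s : ℂ} (hs : 0 < s.re) (h1 : s ≠ 1) :
    ‖zetaTermDiff n s‖ ≤ ‖s‖ * ((n : ℝ) + 1) ^ (-s.re - 1) := by
  set a : ℝ := n + 1 with ha
  have hapos : 0 < a := by positivity
  have hcpow : ∀ u : ℝ, 0 ≤ u → ‖((a : ℂ) + u) ^ (-s - 1)‖ ≤ a ^ (-s.re - 1) := by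
    intro u hu
    rw [← Complex.ofReal_add, Complex.norm_cpow_eq_rpow_re_of_pos (by positivity)]
    simp only [Complex.sub_re, Complex.neg_re, Complex.one_re]
    exact Real.rpow_le_rpow_of_nonpos hapos (by linarith) (by linarith)
  have hstep : ∀ u ∈ Set.Icc (0 : ℝ) 1,
      ‖((a : ℂ) + u) ^ (-s) - (a : ℂ) ^ (-s)‖ ≤ ‖s‖ * a ^ (-s.re - 1) := by
    intro u hu
    have h := norm_image_sub_le_of_norm_deriv_le_segment'
      (f := fun x : ℝ => ((a : ℂ) + x) ^ (-s)) (a := 0) (b := 1) (C := ‖s‖ * a ^ (-s.re - 1))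
      (fun x hx => (hasDerivAt_add_cpow (by linarith [hx.1]) (-s)).hasDerivWithinAt)
      (fun x hx => by
        rw [norm_mul, norm_neg]
        gcongr
        exact hcpow x hx.1) u hu
    simp only [Complex.ofReal_zero, add_zero, sub_zero] at h
    refine h.trans (mul_le_of_le_one_right (by positivity) hu.2)
  have h1s : 1 - s ≠ 0 := sub_ne_zero.2 h1.symm
  have h := norm_image_sub_le_of_norm_deriv_le_segment_01'
    (f := fun x : ℝ => ((a : ℂ) + x) ^ (1 - s) / (1 - s) - x * (a : ℂ) ^ (-s))
    (f' := fun x : ℝ => ((a : ℂ) + x) ^ (-s) - (a : ℂ) ^ (-s))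
    (C := ‖s‖ * a ^ (-s.re - 1))
    (fun x hx => by
      have e1 := (hasDerivAt_add_cpow (by linarith [hx.1] : 0 < a + x) (1 - s)).div_const (1 - s)
      have e2 := (Complex.ofRealCLM.hasDerivAt (x := x)).mul_const ((a : ℂ) ^ (-s))
      refine (HasDerivAt.congr_deriv (e1.sub e2) ?_).hasDerivWithinAt
      rw [mul_div_cancel_left₀ _ h1s, show (1 - s - 1) = -s by ring]
      simp)
    (fun x hx => hstep x ⟨hx.1, hx.2.le⟩)
  refine le_of_eq_of_le ?_ h
  rw [← norm_neg, zetaTermDiff]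
  congr 1
  simp only [ha, Complex.ofReal_add, Complex.ofReal_natCast, Complex.ofReal_one,
    Complex.ofReal_zero, add_zero, zero_mul, sub_zero, one_mul]
  rw [show (n : ℂ) + 1 + 1 = n + 2 by ring]
  ring

lemma summable_rpow_neg {σ : ℝ} (hσ : 0 < σ) :
    Summable fun n : ℕ => ((n : ℝ) + 1) ^ (-σ - 1) := by
  have := (summable_nat_add_iff 1).2 (Real.summable_nat_rpow.2 (by linarith : -σ - 1 < -1))
  simpa using this

lemma differentiableAt_zetaTermDiff (n : ℕ) {s : ℂ} (h1 : s ≠ 1) :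
    DifferentiableAt ℂ (zetaTermDiff n) s := by
  have h1s : 1 - s ≠ 0 := sub_ne_zero.2 h1.symm
  have ha : (n : ℂ) + 1 ≠ 0 := by exact_mod_cast n.succ_ne_zero
  have hb : (n : ℂ) + 2 ≠ 0 := by exact_mod_cast (n + 1).succ_ne_zero
  unfold zetaTermDiff
  refine DifferentiableAt.sub ?_ (DifferentiableAt.div (DifferentiableAt.sub ?_ ?_) ?_ h1s)
  · exact DifferentiableAt.const_cpow (by fun_prop) (Or.inl ha)
  · exact DifferentiableAt.const_cpow (by fun_prop) (Or.inl hb)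
  · exact DifferentiableAt.const_cpow (by fun_prop) (Or.inl ha)
  · fun_prop

/-- The integrals telescope to `((N+1)^(1-s) - 1)/(1-s)`, which tends to `1/(s-1)`. -/
lemma zeta_eq_tsum_of_one_lt_re {s : ℂ} (hs : 1 < s.re) :
    riemannZeta s = (s - 1)⁻¹ + ∑' n, zetaTermDiff n s := by
  have h1 : s ≠ 1 := by
    rintro rfl
    simp at hs
  have h1s : 1 - s ≠ 0 := sub_ne_zero.2 h1.symm
  have hsum : Summable fun n => zetaTermDiff n s :=
    Summable.of_norm_bounded ((summable_rpow_neg (by linarith)).mul_left _)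
      fun n => norm_zetaTermDiff_le n (by linarith) h1
  have hz : HasSum (fun n : ℕ => ((n : ℂ) + 1) ^ (-s)) (riemannZeta s) := by
    have h2 := zeta_eq_tsum_one_div_nat_add_one_cpow hs
    have h3 : Summable fun n : ℕ => 1 / ((n : ℂ) + 1) ^ s := by
      have := (summable_nat_add_iff 1).2 (Complex.summable_one_div_nat_cpow.2 hs)
      simpa using this
    rw [h2]
    simpa [Complex.cpow_neg] using h3.hasSum
  have ht : Tendsto (fun N : ℕ => ((N : ℂ) + 1) ^ (1 - s)) atTop (𝓝 0) := by
    rw [tendsto_zero_iff_norm_tendsto_zero]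
    have e : ∀ N : ℕ, ‖((N : ℂ) + 1) ^ (1 - s)‖ = ((N : ℝ) + 1) ^ (-(s.re - 1)) := by
      intro N
      have : ((N : ℂ) + 1) = ((N + 1 : ℝ) : ℂ) := by push_cast; rfl
      rw [this, Complex.norm_cpow_eq_rpow_re_of_pos (by positivity)]
      simp
    simp only [e]
    have h4 := (tendsto_rpow_neg_atTop (by linarith : 0 < s.re - 1))
    exact h4.comp (tendsto_atTop_add_const_right _ 1 tendsto_natCast_atTop_atTop)
  have htel : ∀ N : ℕ, ∑ n ∈ Finset.range N, zetaTermDiff n s =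
      ∑ n ∈ Finset.range N, ((n : ℂ) + 1) ^ (-s) - (((N : ℂ) + 1) ^ (1 - s) - 1) / (1 - s) := by
    intro N
    simp only [zetaTermDiff]
    rw [Finset.sum_sub_distrib, ← Finset.sum_div]
    congr 2
    have := Finset.sum_range_sub (fun n : ℕ => ((n : ℂ) + 1) ^ (1 - s)) N
    simp only [Nat.cast_add, Nat.cast_one, Nat.cast_zero, zero_add, Complex.one_cpow] at this
    rw [← this]
    refine Finset.sum_congr rfl fun n _ => ?_
    rw [show (n : ℂ) + 1 + 1 = n + 2 by ring]
  have hlim := hsum.hasSum.tendsto_sum_nat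
  simp only [htel] at hlim
  have hlim2 := hz.tendsto_sum_nat.sub ((ht.sub_const 1).div_const (1 - s))
  have := tendsto_nhds_unique hlim hlim2
  rw [this]
  have h2s : s - 1 ≠ 0 := sub_ne_zero.2 h1
  field_simp
  ring

/-- Analytic continuation from `Re s > 1`: the region `U` is convex, avoids the pole, and is bounded
and away from `Re z = 0`, so the series converges uniformly there. -/
lemma zeta_eq_tsum {s : ℂ} (hs : 0 < s.re) (him : 0 < s.im) :
    riemannZeta s = (s - 1)⁻¹ + ∑' n, zetaTermDiff n s := by
  set U : Set ℂ := {z | s.re / 2 < z.re} ∩ {z | 0 < z.im} ∩ Metric.ball 0 (‖s‖ + 10) with hU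
  have hUo : IsOpen U :=
    ((isOpen_lt continuous_const Complex.continuous_re).inter
      (isOpen_lt continuous_const Complex.continuous_im)).inter Metric.isOpen_ball
  have hUc : Convex ℝ U :=
    ((convex_halfSpace_re_gt _).inter (convex_halfSpace_im_gt _)).inter (convex_ball _ _)
  have hne : ∀ z ∈ U, z ≠ 1 := fun z hz => ne_one_of_im_pos hz.1.2
  have hd : DifferentiableOn ℂ (fun z => ∑' n, zetaTermDiff n z) U := by
    refine Complex.differentiableOn_tsum_of_summable_norm
      (u := fun n : ℕ => (‖s‖ + 10) * ((n : ℝ) + 1) ^ (-(s.re / 2) - 1))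
      ((summable_rpow_neg (by linarith)).mul_left _)
      (fun n z hz => (differentiableAt_zetaTermDiff n (hne z hz)).differentiableWithinAt) hUo
      fun n z hz => ?_
    have h1 : s.re / 2 < z.re := hz.1.1
    refine (norm_zetaTermDiff_le n (by linarith) (hne z hz)).trans ?_
    have h2 : ‖z‖ ≤ ‖s‖ + 10 := (mem_ball_zero_iff.1 hz.2).le
    have h3 : (1 : ℝ) ≤ n + 1 := by simp
    gcongr
  have hz0 : DifferentiableOn ℂ riemannZeta U := fun z hz =>
    (differentiableAt_riemannZeta (hne z hz)).differentiableWithinAt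
  have hd2 : DifferentiableOn ℂ (fun z => (z - 1)⁻¹ + ∑' n, zetaTermDiff n z) U := by
    refine DifferentiableOn.add (fun z hz => ?_) hd
    have := sub_ne_zero.2 (hne z hz)
    fun_prop (disch := assumption)
  have hp : (⟨s.re + 2, 1⟩ : ℂ) ∈ U := by
    refine ⟨⟨?_, ?_⟩, ?_⟩
    · show s.re / 2 < s.re + 2
      linarith
    · show (0 : ℝ) < 1
      norm_num
    · rw [mem_ball_zero_iff]
      refine (Complex.norm_le_abs_re_add_abs_im _).trans_lt ?_
      have := Complex.abs_re_le_norm s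
      rw [abs_of_pos hs] at this
      simp only [abs_one]
      rw [abs_of_pos (by linarith)]
      linarith
  have heq := (hz0.analyticOnNhd hUo).eqOn_of_preconnected_of_eventuallyEq
    (hd2.analyticOnNhd hUo) hUc.isPreconnected hp (by
      have : {z : ℂ | 1 < z.re} ∈ 𝓝 (⟨s.re + 2, 1⟩ : ℂ) :=
        (isOpen_lt continuous_const Complex.continuous_re).mem_nhds (by
          show 1 < s.re + 2
          linarith)
      filter_upwards [this] with z hz using zeta_eq_tsum_of_one_lt_re hz)
  refine heq ⟨⟨?_, him⟩, ?_⟩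
  · show s.re / 2 < s.re
    linarith
  · rw [mem_ball_zero_iff]
    linarith

/-- Only the logarithm of this bound enters Landau's lemma, so any fixed power of `‖s‖` would serve.
-/
theorem exists_norm_zeta_le {σ : ℝ} (hσ : 0 < σ) :
    ∃ C : ℝ, 1 ≤ C ∧ ∀ s : ℂ, σ ≤ s.re → 1 ≤ s.im → ‖riemannZeta s‖ ≤ C * ‖s‖ := by
  set S := ∑' n : ℕ, ((n : ℝ) + 1) ^ (-σ - 1)
  have hS : 0 ≤ S := tsum_nonneg fun n => by positivity
  refine ⟨S + 1, by linarith, fun s hs him => ?_⟩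
  have h1 := ne_one_of_im_pos (by linarith : 0 < s.im)
  rw [zeta_eq_tsum (by linarith) (by linarith)]
  have hsn : 1 ≤ ‖s‖ := him.trans ((le_abs_self _).trans (Complex.abs_im_le_norm s))
  have hinv : ‖(s - 1)⁻¹‖ ≤ 1 := by
    rw [norm_inv]
    refine inv_le_one_of_one_le₀ ?_
    have := Complex.abs_im_le_norm (s - 1)
    simp only [Complex.sub_im, Complex.one_im, sub_zero] at this
    linarith [le_abs_self s.im]
  have hts : ‖∑' n, zetaTermDiff n s‖ ≤ ‖s‖ * S := by
    rw [← tsum_mul_left]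
    refine tsum_of_norm_bounded ((summable_rpow_neg hσ).mul_left ‖s‖).hasSum fun n => ?_
    refine (norm_zetaTermDiff_le n (by linarith) h1).trans ?_
    have h3 : (1 : ℝ) ≤ n + 1 := by simp
    gcongr
  calc _ ≤ ‖(s - 1)⁻¹‖ + ‖∑' n, zetaTermDiff n s‖ := norm_add_le _ _
    _ ≤ 1 + ‖s‖ * S := add_le_add hinv hts
    _ ≤ _ := by linarith

/-- The terms after the first sum to at most `π²/6 - 1 < 2/3` in modulus. This controls the centre
of the Landau disc. -/
lemma one_third_le_norm_zeta (t : ℝ) : 1 / 3 ≤ ‖riemannZeta ⟨2, t⟩‖ := by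
  set s : ℂ := ⟨2, t⟩
  have hre : s.re = 2 := rfl
  have hs : 1 < s.re := by rw [hre]; norm_num
  have hsum : Summable fun n : ℕ => 1 / ((n : ℂ) + 1) ^ s := by
    have := (summable_nat_add_iff 1).2 (Complex.summable_one_div_nat_cpow.2 hs)
    simpa using this
  have hb : HasSum (fun n : ℕ => 1 / ((n : ℝ) + 2) ^ 2) (Real.pi ^ 2 / 6 - 1) := by
    have := (hasSum_nat_add_iff' 2).2 hasSum_zeta_two
    simpa [Finset.sum_range_succ] using this
  have htail : ‖∑' n : ℕ, 1 / (((n + 1 : ℕ) : ℂ) + 1) ^ s‖ ≤ Real.pi ^ 2 / 6 - 1 := by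
    refine tsum_of_norm_bounded hb fun n => ?_
    have e : (((n + 1 : ℕ) : ℂ) + 1) = ((n + 2 : ℝ) : ℂ) := by push_cast; ring
    rw [e, norm_div, norm_one, Complex.norm_cpow_eq_rpow_re_of_pos (by positivity), hre]
    norm_num
  rw [zeta_eq_tsum_one_div_nat_add_one_cpow hs, hsum.tsum_eq_zero_add]
  simp only [Nat.cast_zero, zero_add, Complex.one_cpow, div_one]
  have h1 := norm_sub_le_norm_add (1 : ℂ) (∑' n : ℕ, 1 / (((n + 1 : ℕ) : ℂ) + 1) ^ s)
  rw [norm_one] at h1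
  have := Real.pi_lt_d2
  have := Real.pi_pos
  nlinarith

/-! ### The real part of ζ'/ζ on the critical line -/

/-- The derivative of `log |f|` along a horizontal line is the real part of `f'/f`. -/
lemma hasDerivAt_log_norm {f : ℂ → ℂ} {s : ℂ} (hf : DifferentiableAt ℂ f s) (h0 : f s ≠ 0) :
    HasDerivAt (fun u : ℝ => Real.log ‖f (s + u)‖) (logDeriv f s).re 0 := by
  have h1 : HasDerivAt (fun u : ℝ => s + (u : ℂ)) 1 0 := by
    simpa using (Complex.ofRealCLM.hasDerivAt (x := (0 : ℝ))).const_add s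
  have h2 : HasDerivAt f (deriv f s) (s + ((0 : ℝ) : ℂ)) := by simpa using hf.hasDerivAt
  have h3 : HasDerivAt (fun u : ℝ => f (s + u)) (deriv f s) 0 := by
    have := HasDerivAt.comp (0 : ℝ) (h₂ := f) h2 h1
    rwa [mul_one] at this
  have h4 := h3.norm_sq
  simp only [Complex.ofReal_zero, add_zero] at h4
  have hn : 0 < ‖f s‖ := norm_pos_iff.2 h0
  have h5 := (h4.log (by simp [h0])).div_const 2
  have e : (fun u : ℝ => Real.log ‖f (s + u)‖) = fun u : ℝ => Real.log (‖f (s + u)‖ ^ 2) / 2 := by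
    funext u
    rw [Real.log_pow]
    push_cast
    ring
  rw [e]
  refine h5.congr_deriv ?_
  rw [logDeriv_apply, Complex.inner, Complex.div_re, Complex.normSq_eq_norm_sq]
  simp only [Complex.ofReal_zero, add_zero, Complex.mul_re, Complex.conj_re, Complex.conj_im]
  field_simp
  ring

lemma norm_GammaSeq_mul_le {x x' : ℝ} (hx : 0 < x) (hxx : x ≤ x') (y : ℝ) {n : ℕ} (hn : 0 < n) :
    ‖Complex.GammaSeq (x + y * Complex.I) n‖ * ‖Complex.GammaSeq x' n‖ ≤
      ‖Complex.GammaSeq (x' + y * Complex.I) n‖ * ‖Complex.GammaSeq x n‖ := by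
  have hx' : 0 < x' := hx.trans_le hxx
  have hnorm : ∀ u v : ℝ, ‖Complex.GammaSeq (u + v * Complex.I) n‖ =
      (n : ℝ) ^ u * n.factorial /
        ∏ j ∈ Finset.range (n + 1), ‖(u : ℂ) + v * Complex.I + j‖ := by
    intro u v
    rw [Complex.GammaSeq, norm_div, norm_mul, norm_prod, Complex.norm_natCast_cpow_of_pos hn]
    simp
  have hnorm0 : ∀ u : ℝ, ‖Complex.GammaSeq u n‖ = (n : ℝ) ^ u * n.factorial /
        ∏ j ∈ Finset.range (n + 1), ‖(u : ℂ) + j‖ := by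
    intro u
    simpa using hnorm u 0
  have hpos : ∀ u v : ℝ, 0 < u →
      0 < ∏ j ∈ Finset.range (n + 1), ‖(u : ℂ) + v * Complex.I + j‖ := by
    intro u v hu
    refine Finset.prod_pos fun j _ => norm_pos_iff.2 fun h => ?_
    have := congrArg Complex.re h
    simp at this
    have hj : (0 : ℝ) ≤ j := j.cast_nonneg
    linarith
  have hpos0 : ∀ u : ℝ, 0 < u → 0 < ∏ j ∈ Finset.range (n + 1), ‖(u : ℂ) + j‖ := by
    intro u hu
    simpa using hpos u 0 hu
  -- Powers of `n` and factorials cancel between the two sides, leaving a comparison factor by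
  -- factor, which after squaring says `y² (x+j)² ≤ y² (x'+j)²`.
  have key : (∏ j ∈ Finset.range (n + 1), ‖(x' : ℂ) + y * Complex.I + j‖) *
      ∏ j ∈ Finset.range (n + 1), ‖(x : ℂ) + j‖ ≤
      (∏ j ∈ Finset.range (n + 1), ‖(x : ℂ) + y * Complex.I + j‖) *
      ∏ j ∈ Finset.range (n + 1), ‖(x' : ℂ) + j‖ := by
    rw [← Finset.prod_mul_distrib, ← Finset.prod_mul_distrib]
    refine Finset.prod_le_prod (fun _ _ => by positivity) fun j _ => ?_
    rw [← norm_mul, ← norm_mul]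
    refine le_of_sq_le_sq ?_ (norm_nonneg _)
    rw [← Complex.normSq_eq_norm_sq, ← Complex.normSq_eq_norm_sq, Complex.normSq_mul,
      Complex.normSq_mul]
    simp only [Complex.normSq_apply, Complex.add_re, Complex.add_im, Complex.ofReal_re,
      Complex.ofReal_im, Complex.mul_re, Complex.mul_im, Complex.I_re, Complex.I_im,
      Complex.natCast_re, Complex.natCast_im]
    have hj : (0 : ℝ) ≤ j := j.cast_nonneg
    have h1 : (x + j) ^ 2 ≤ (x' + j) ^ 2 := by gcongr
    nlinarith [mul_le_mul_of_nonneg_left h1 (sq_nonneg y)]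
  rw [hnorm, hnorm, hnorm0, hnorm0, div_mul_div_comm, div_mul_div_comm]
  rw [div_le_div_iff₀ (mul_pos (hpos x y hx) (hpos0 x' hx'))
    (mul_pos (hpos x' y hx') (hpos0 x hx))]
  have : (0 : ℝ) ≤ (n : ℝ) ^ x * n.factorial * ((n : ℝ) ^ x' * n.factorial) := by positivity
  calc _ ≤ (n : ℝ) ^ x * n.factorial * ((n : ℝ) ^ x' * n.factorial) * _ :=
        mul_le_mul_of_nonneg_left key this
    _ = _ := by ring

/-- `|Γ(x + iy)| / Γ(x)` is nondecreasing in `x`. -/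
lemma norm_Gamma_mul_le {x x' : ℝ} (hx : 0 < x) (hxx : x ≤ x') (y : ℝ) :
    ‖Complex.Gamma (x + y * Complex.I)‖ * ‖Complex.Gamma x'‖ ≤
      ‖Complex.Gamma (x' + y * Complex.I)‖ * ‖Complex.Gamma x‖ := by
  refine le_of_tendsto_of_tendsto
    ((Complex.GammaSeq_tendsto_Gamma _).norm.mul (Complex.GammaSeq_tendsto_Gamma _).norm)
    ((Complex.GammaSeq_tendsto_Gamma _).norm.mul (Complex.GammaSeq_tendsto_Gamma _).norm) ?_
  filter_upwards [eventually_gt_atTop 0] with n hn using norm_GammaSeq_mul_le hx hxx y hn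

lemma ne_neg_nat_of_re_pos {s : ℂ} (hs : 0 < s.re) (m : ℕ) : s ≠ -m := by
  rintro rfl
  simp at hs
  have : (0 : ℝ) ≤ m := m.cast_nonneg
  linarith

/-- The difference of the two sides is the derivative at 0 of `log (|Γ(x+u+iy)| / Γ(x+u))`, which is
nondecreasing in `u`. -/
lemma re_digamma_ofReal_le {x : ℝ} (hx : 0 < x) (y : ℝ) :
    (Complex.digamma x).re ≤ (Complex.digamma (x + y * Complex.I)).re := by
  have hre1 : 0 < ((x : ℂ) + y * Complex.I).re := by simpa
  have hre0 : 0 < (x : ℂ).re := by simpa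
  have hd := (hasDerivAt_log_norm
    (Complex.differentiableAt_Gamma _ (ne_neg_nat_of_re_pos hre1))
    (Complex.Gamma_ne_zero_of_re_pos hre1)).sub (hasDerivAt_log_norm
    (Complex.differentiableAt_Gamma _ (ne_neg_nat_of_re_pos hre0))
    (Complex.Gamma_ne_zero_of_re_pos hre0))
  rw [← sub_nonneg, Complex.digamma_def]
  set φ : ℝ → ℝ := (fun u : ℝ => Real.log ‖Complex.Gamma (x + y * Complex.I + u)‖) -
    fun u : ℝ => Real.log ‖Complex.Gamma (x + u)‖ with hφ
  have hmono : MonotoneOn φ (Set.Ioi (-x)) := by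
    intro u hu v hv huv
    rw [Set.mem_Ioi] at hu hv
    have h := norm_Gamma_mul_le (by linarith : 0 < x + u) (by linarith : x + u ≤ x + v) y
    have hp : ∀ a b : ℝ, 0 < a → 0 < ‖Complex.Gamma ((a : ℂ) + b * Complex.I)‖ :=
      fun a b ha => norm_pos_iff.2 (Complex.Gamma_ne_zero_of_re_pos (by simpa))
    have hp0 : ∀ a : ℝ, 0 < a → 0 < ‖Complex.Gamma (a : ℂ)‖ :=
      fun a ha => norm_pos_iff.2 (Complex.Gamma_ne_zero_of_re_pos (by simpa))
    have hu1 : 0 < x + u := by linarith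
    have hv1 : 0 < x + v := by linarith
    have h2 := Real.log_le_log (mul_pos (hp _ y hu1) (hp0 _ hv1)) h
    rw [Real.log_mul (hp _ y hu1).ne' (hp0 _ hv1).ne',
      Real.log_mul (hp _ y hv1).ne' (hp0 _ hu1).ne'] at h2
    simp only [hφ, Pi.sub_apply]
    push_cast at h2
    rw [show (x : ℂ) + y * Complex.I + u = x + u + y * Complex.I by ring,
      show (x : ℂ) + y * Complex.I + v = x + v + y * Complex.I by ring]
    linarith
  have h0 : (0 : ℝ) ∈ Set.Ioi (-x) := by
    rw [Set.mem_Ioi]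
    linarith
  have := hmono.derivWithin_nonneg (x := 0)
  rwa [derivWithin_of_isOpen isOpen_Ioi h0, hd.deriv] at this

lemma digamma_add_nat {s : ℂ} (hs : 0 < s.re) (n : ℕ) :
    Complex.digamma (s + n) = Complex.digamma s + ∑ k ∈ Finset.range n, (s + k)⁻¹ := by
  induction n with
  | zero => simp
  | succ n ih =>
    have : 0 < (s + n).re := by
      simp only [Complex.add_re, Complex.natCast_re]
      positivity
    rw [Finset.sum_range_succ, ← add_assoc, ← ih,
      ← Complex.digamma_apply_add_one _ (ne_neg_nat_of_re_pos this)]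
    push_cast
    rw [add_assoc]

/-- A lower bound for the digamma function on the line `Re s = 1/4`. -/
lemma re_digamma_lower {y : ℝ} (hy : 1 ≤ y) :
    (Complex.digamma ((1 / 4 : ℝ) : ℂ)).re + Real.log y / 2 ≤
      (Complex.digamma (((1 / 4 : ℝ) : ℂ) + y * Complex.I)).re := by
  set x : ℝ := 1 / 4 with hx
  -- Both arguments are shifted by `n` with the recurrence and compared there. For `k < n` one has
  -- `x + k ≤ y`, so the real part of `1/(x+k+iy)` is at most half of `1/(x+k)`; the other halves
  -- add up to at least `log y / 2`.
  set n := ⌊y⌋₊ with hn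
  have hny : (n : ℝ) ≤ y := Nat.floor_le (by linarith)
  have h1 := digamma_add_nat (s := (x : ℂ)) (by simp [hx]) n
  have h2 := digamma_add_nat (s := (x : ℂ) + y * Complex.I) (by simp [hx]) n
  have h3 := re_digamma_ofReal_le (x := x + n) (by positivity) y
  push_cast at h3
  rw [show (x : ℂ) + n + y * Complex.I = x + y * Complex.I + n by ring, h1, h2] at h3
  simp only [Complex.add_re, Complex.re_sum] at h3
  have h4 : ∑ k ∈ Finset.range n, ((x : ℂ) + y * Complex.I + k)⁻¹.re + Real.log y / 2 ≤
      ∑ k ∈ Finset.range n, ((x : ℂ) + k)⁻¹.re := by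
    have hh : Real.log y ≤ (harmonic n : ℝ) := log_le_harmonic_floor y (by linarith)
    have hsum : (harmonic n : ℝ) = ∑ k ∈ Finset.range n, ((k : ℝ) + 1)⁻¹ := by
      simp [harmonic]
    rw [hsum] at hh
    have : ∑ k ∈ Finset.range n, (((x : ℂ) + y * Complex.I + k)⁻¹.re + ((k : ℝ) + 1)⁻¹ / 2) ≤
        ∑ k ∈ Finset.range n, ((x : ℂ) + k)⁻¹.re := by
      refine Finset.sum_le_sum fun k hk => ?_
      have hk1 : (k : ℝ) + 1 ≤ n := by exact_mod_cast Finset.mem_range.1 hk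
      have hk0 : (0 : ℝ) ≤ k := k.cast_nonneg
      have e1 : ((x : ℂ) + y * Complex.I + k)⁻¹.re = (x + k) / ((x + k) ^ 2 + y ^ 2) := by
        rw [Complex.inv_re, Complex.normSq_apply]
        simp
        ring
      have e2 : ((x : ℂ) + k)⁻¹.re = (x + k)⁻¹ := by
        rw [← Complex.ofReal_natCast, ← Complex.ofReal_add, ← Complex.ofReal_inv,
          Complex.ofReal_re]
      rw [e1, e2]
      have hxk : 0 < x + k := by positivity
      have hxy : x + k ≤ y := by rw [hx]; linarith
      have f1 : (x + k) / ((x + k) ^ 2 + y ^ 2) ≤ (x + k)⁻¹ / 2 := by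
        rw [inv_eq_one_div, div_div, div_le_div_iff₀ (by positivity) (by positivity)]
        nlinarith
      have f2 : ((k : ℝ) + 1)⁻¹ ≤ (x + k)⁻¹ := by
        apply inv_anti₀ hxk
        rw [hx]; linarith
      linarith
    rw [Finset.sum_add_distrib, ← Finset.sum_div] at this
    linarith
  linarith

lemma completedRiemannZeta_conj (s : ℂ) (h0 : 0 < s.re) :
    completedRiemannZeta (starRingEnd ℂ s) = starRingEnd ℂ (completedRiemannZeta s) := by
  have hs : s ≠ 0 := by
    rintro rfl
    simp at h0
  have hs' : starRingEnd ℂ s ≠ 0 := by simpa using hs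
  have hG : ∀ z : ℂ, 0 < z.re → completedRiemannZeta z = riemannZeta z * z.Gammaℝ := by
    intro z hz
    have hz0 : z ≠ 0 := by
      rintro rfl
      simp at hz
    rw [riemannZeta_def_of_ne_zero hz0, div_mul_cancel₀ _ (Complex.Gammaℝ_ne_zero_of_re_pos hz)]
  rw [hG _ (by simpa using h0), hG s h0, map_mul, riemannZeta_conj]
  congr 1
  rw [Complex.Gammaℝ_def, Complex.Gammaℝ_def, map_mul, ← Complex.Gamma_conj]
  congr 1
  · have : (Real.pi : ℂ).arg ≠ Real.pi := by
      rw [Complex.arg_ofReal_of_nonneg Real.pi_pos.le]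
      exact Real.pi_pos.ne
    have h := Complex.cpow_conj Real.pi (-s / 2) this
    rw [Complex.conj_ofReal] at h
    rw [← h, map_div₀, map_neg, map_ofNat]
  · rw [map_div₀, map_ofNat]

/-- The functional equation combined with conjugation makes `u ↦ log |Λ(s + u)|` even near 0, so its
derivative there vanishes. -/
lemma re_logDeriv_completedZeta {t : ℝ} (ht : 0 < t) (h0 : completedRiemannZeta ⟨1 / 2, t⟩ ≠ 0) :
    (logDeriv completedRiemannZeta ⟨1 / 2, t⟩).re = 0 := by
  set s : ℂ := ⟨1 / 2, t⟩ with hs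
  have hs0 : s ≠ 0 := fun h => by
    have := congrArg Complex.im h
    simp [hs] at this
    linarith
  have hs1 : s ≠ 1 := fun h => by
    have := congrArg Complex.im h
    simp [hs] at this
    linarith
  have hd := hasDerivAt_log_norm (differentiableAt_completedZeta hs0 hs1) h0
  have heven : (fun u : ℝ => Real.log ‖completedRiemannZeta (s + u)‖) =ᶠ[𝓝 0]
      fun u : ℝ => Real.log ‖completedRiemannZeta (s + ((-u : ℝ) : ℂ))‖ := by
    filter_upwards [Ioo_mem_nhds (show (-1 / 2 : ℝ) < 0 by norm_num)
      (show (0 : ℝ) < 1 / 2 by norm_num)] with u hu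
    have e : 1 - (s + u) = starRingEnd ℂ (s + ((-u : ℝ) : ℂ)) := by
      apply Complex.ext
      · simp [hs]
        ring
      · simp [hs]
    rw [← completedRiemannZeta_one_sub, e, completedRiemannZeta_conj, Complex.norm_conj]
    simp [hs]
    linarith [hu.2]
  have hneg : HasDerivAt (fun u : ℝ => Real.log ‖completedRiemannZeta (s + ((-u : ℝ) : ℂ))‖)
      (-(logDeriv completedRiemannZeta s).re) 0 := by
    have h1 : HasDerivAt (fun u : ℝ => Real.log ‖completedRiemannZeta (s + u)‖)
      (logDeriv completedRiemannZeta s).re (-0) := by simpa using hd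
    have := HasDerivAt.scomp (0 : ℝ) (g₁ := fun u : ℝ => Real.log ‖completedRiemannZeta (s + u)‖)
      h1 (hasDerivAt_neg (0 : ℝ))
    simpa [Function.comp_def] using this
  have := (hneg.congr_of_eventuallyEq heven).unique hd
  linarith

lemma logDeriv_Gammaℝ {s : ℂ} (hs : 0 < s.re) :
    logDeriv Complex.Gammaℝ s = -(Complex.log Real.pi) / 2 + Complex.digamma (s / 2) / 2 := by
  have hpi : (Real.pi : ℂ) ≠ 0 := by exact_mod_cast Real.pi_ne_zero
  have hs2 : 0 < (s / 2).re := by simpa using hs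
  have hG := Complex.differentiableAt_Gamma _ (ne_neg_nat_of_re_pos hs2)
  have h1 : HasDerivAt (fun z : ℂ => (Real.pi : ℂ) ^ (-z / 2))
      ((Real.pi : ℂ) ^ (-s / 2) * Complex.log Real.pi * (-1 / 2)) s :=
    (((hasDerivAt_id s).neg).div_const 2).const_cpow (Or.inl hpi)
  have h2 : HasDerivAt (fun z : ℂ => Complex.Gamma (z / 2))
      (deriv Complex.Gamma (s / 2) * (1 / 2)) s :=
    HasDerivAt.comp s (h₂ := Complex.Gamma) hG.hasDerivAt ((hasDerivAt_id s).div_const 2)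
  have h3 : HasDerivAt Complex.Gammaℝ _ s := h1.mul h2
  rw [logDeriv_apply, h3.deriv, Complex.Gammaℝ_def, Complex.digamma_def, logDeriv_apply]
  have h4 : (Real.pi : ℂ) ^ (-s / 2) ≠ 0 := by simp [Complex.cpow_eq_zero_iff, hpi]
  have h5 := Complex.Gamma_ne_zero_of_re_pos hs2
  field_simp

theorem exists_re_logDeriv_zeta_le :
    ∃ T : ℝ, 1 ≤ T ∧ ∀ t : ℝ, T ≤ t → riemannZeta ⟨1 / 2, t⟩ ≠ 0 →
      (logDeriv riemannZeta ⟨1 / 2, t⟩).re ≤ -(1 / 8) * Real.log t := by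
  -- The estimates below give `Re ζ'/ζ ≤ A/8 - (log t)/4`. Taking `log t ≥ A` absorbs the constant
  -- into half of the main term.
  set A : ℝ := 8 * (Real.log Real.pi / 2 - (Complex.digamma ((1 / 4 : ℝ) : ℂ)).re / 2
    + Real.log 2 / 4) with hA
  refine ⟨max 2 (Real.exp A), by linarith [le_max_left 2 (Real.exp A)], fun t ht h0 => ?_⟩
  have ht2 : 2 ≤ t := (le_max_left _ _).trans ht
  have htA : A ≤ Real.log t := by
    rw [Real.le_log_iff_exp_le (by linarith)]
    exact (le_max_right _ _).trans ht
  set s : ℂ := ⟨1 / 2, t⟩ with hs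
  have hsre : 0 < s.re := by simp [hs]
  have hs0 : s ≠ 0 := by
    intro h
    simp [h] at hsre
  have hs1 : s ≠ 1 := ne_one_of_im_pos (show 0 < t by linarith)
  have hdef := riemannZeta_def_of_ne_zero hs0
  have hL0 : completedRiemannZeta s ≠ 0 := by
    intro h
    rw [hdef, h, zero_div] at h0
    exact h0 rfl
  have hG0 := Complex.Gammaℝ_ne_zero_of_re_pos hsre
  have hGd : DifferentiableAt ℂ Complex.Gammaℝ s := by
    have := (Complex.differentiable_Gammaℝ_inv s).fun_inv (inv_ne_zero hG0)
    simpa only [inv_inv] using this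
  have he : riemannZeta =ᶠ[𝓝 s] fun z => completedRiemannZeta z / Complex.Gammaℝ z := by
    filter_upwards [isOpen_ne.mem_nhds hs0] with z hz using riemannZeta_def_of_ne_zero hz
  have h1 : logDeriv riemannZeta s = logDeriv completedRiemannZeta s - logDeriv Complex.Gammaℝ s := by
    rw [← logDeriv_div s hL0 hG0 (differentiableAt_completedZeta hs0 hs1) hGd, logDeriv_apply,
      logDeriv_apply, he.deriv_eq, he.eq_of_nhds]
  have h2 := re_logDeriv_completedZeta (by linarith : 0 < t) hL0
  have h3 := logDeriv_Gammaℝ hsre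
  have h4 := re_digamma_lower (y := t / 2) (by linarith)
  have e : s / 2 = ((1 / 4 : ℝ) : ℂ) + (t / 2 : ℝ) * Complex.I := by
    apply Complex.ext
    · simp [hs]
      norm_num
    · simp [hs]
  rw [e] at h3
  have h5 : (Complex.log Real.pi).re = Real.log Real.pi := by
    rw [← Complex.ofReal_log Real.pi_pos.le, Complex.ofReal_re]
  rw [h1, Complex.sub_re, h2, h3]
  have hdiv : ∀ w : ℂ, (w / 2).re = w.re / 2 := fun w => by simp
  rw [Complex.add_re, hdiv, hdiv, Complex.neg_re, h5]
  rw [Real.log_div (by linarith) (by norm_num)] at h4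
  linarith

/-! ### Sums over spaced points -/

lemma floor_div_injOn_of_spaced {ι : Type*} {S : Finset ι} {x : ι → ℝ} {a : ℝ} (ha : 0 < a)
    (hx : ∀ i ∈ S, 0 ≤ x i) (hsp : ∀ i ∈ S, ∀ j ∈ S, i ≠ j → a ≤ |x i - x j|) :
    Set.InjOn (fun i => ⌊x i / a⌋₊) S := by
  intro i hi j hj hij
  by_contra hne
  have h1 := hsp i hi j hj hne
  have hi0 : 0 ≤ x i / a := div_nonneg (hx i hi) ha.le
  have hj0 : 0 ≤ x j / a := div_nonneg (hx j hj) ha.le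
  simp only at hij
  have h2 := Nat.floor_le hi0
  have h3 := Nat.lt_floor_add_one (x i / a)
  have h4 := Nat.floor_le hj0
  have h5 := Nat.lt_floor_add_one (x j / a)
  rw [hij] at h2 h3
  have h6 : |x i / a - x j / a| < 1 := abs_lt.2 ⟨by linarith, by linarith⟩
  rw [← sub_div, abs_div, abs_of_pos ha, div_lt_one ha] at h6
  linarith

lemma floor_div_mem_range {ι : Type*} {S : Finset ι} {x : ι → ℝ} {a B : ℝ} (ha : 0 < a)
    (hB : ∀ i ∈ S, x i ≤ B) :
    ∀ i ∈ S, ⌊x i / a⌋₊ ∈ Finset.range (⌊B / a⌋₊ + 1) := by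
  intro i hi
  rw [Finset.mem_range, Nat.lt_succ_iff]
  exact Nat.floor_mono (div_le_div_of_nonneg_right (hB i hi) ha.le)

/-- The number of points of a spaced set in an interval. -/
lemma card_le_of_spaced {ι : Type*} {S : Finset ι} {x : ι → ℝ} {a B : ℝ} (ha : 0 < a)
    (hB0 : 0 ≤ B) (hx : ∀ i ∈ S, 0 ≤ x i) (hB : ∀ i ∈ S, x i ≤ B)
    (hsp : ∀ i ∈ S, ∀ j ∈ S, i ≠ j → a ≤ |x i - x j|) :
    (S.card : ℝ) ≤ B / a + 1 := by
  have h1 := Finset.card_le_card_of_injOn (fun i => ⌊x i / a⌋₊) (floor_div_mem_range ha hB)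
    (floor_div_injOn_of_spaced ha hx hsp)
  rw [Finset.card_range] at h1
  have h2 := Nat.floor_le (div_nonneg hB0 ha.le)
  have h3 : (S.card : ℝ) ≤ (⌊B / a⌋₊ : ℝ) + 1 := by exact_mod_cast h1
  linarith

/-- Spaced points occupy distinct cells `m = ⌊x/a⌋`, and `x ≥ a/2` gives `m + 1 ≤ 3x/a`; the sum is
dominated by `3/a` times a harmonic sum. -/
lemma sum_inv_le_of_spaced_of_pos {ι : Type*} {S : Finset ι} {x : ι → ℝ} {a B : ℝ} (ha : 0 < a)
    (hB0 : 0 ≤ B) (hx : ∀ i ∈ S, a / 2 ≤ x i) (hB : ∀ i ∈ S, x i ≤ B)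
    (hsp : ∀ i ∈ S, ∀ j ∈ S, i ≠ j → a ≤ |x i - x j|) :
    ∑ i ∈ S, (x i)⁻¹ ≤ 3 / a * (1 + Real.log (B / a + 1)) := by
  have hpos : ∀ i ∈ S, 0 < x i := fun i hi => (half_pos ha).trans_le (hx i hi)
  have h1 : ∀ i ∈ S, (x i)⁻¹ ≤ 3 / a * ((⌊x i / a⌋₊ : ℝ) + 1)⁻¹ := by
    intro i hi
    have h2 := Nat.floor_le (div_nonneg (hpos i hi).le ha.le)
    rw [le_div_iff₀ ha] at h2
    have h3 := hx i hi
    have h4 := hpos i hi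
    rw [← div_eq_mul_inv, div_div, inv_eq_one_div, div_le_div_iff₀ h4 (by positivity)]
    linarith
  have h5 : ∑ i ∈ S, ((⌊x i / a⌋₊ : ℝ) + 1)⁻¹ ≤ (harmonic (⌊B / a⌋₊ + 1) : ℝ) := by
    have hinj := floor_div_injOn_of_spaced ha (fun i hi => (hpos i hi).le) hsp
    have e := Finset.sum_image (f := fun m : ℕ => ((m : ℝ) + 1)⁻¹) hinj
    rw [← e]
    simp only [harmonic, Rat.cast_sum, Rat.cast_inv, Rat.cast_natCast]
    push_cast
    refine Finset.sum_le_sum_of_subset_of_nonneg (fun m hm => ?_) fun _ _ _ => by positivity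
    obtain ⟨i, hi, rfl⟩ := Finset.mem_image.1 hm
    exact floor_div_mem_range ha hB i hi
  have h6 := harmonic_le_one_add_log (⌊B / a⌋₊ + 1)
  have h7 : Real.log ((⌊B / a⌋₊ + 1 : ℕ) : ℝ) ≤ Real.log (B / a + 1) := by
    have := Nat.floor_le (div_nonneg hB0 ha.le)
    apply Real.log_le_log (by positivity)
    push_cast
    linarith
  calc ∑ i ∈ S, (x i)⁻¹ ≤ ∑ i ∈ S, 3 / a * ((⌊x i / a⌋₊ : ℝ) + 1)⁻¹ := Finset.sum_le_sum h1
    _ = 3 / a * ∑ i ∈ S, ((⌊x i / a⌋₊ : ℝ) + 1)⁻¹ := by rw [Finset.mul_sum]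
    _ ≤ _ := by
      gcongr
      linarith

/-- The sum of the reciprocals of the absolute values over a spaced set that avoids zero. -/
lemma sum_inv_abs_le_of_spaced {ι : Type*} {S : Finset ι} {x : ι → ℝ} {a B : ℝ}
    (ha : 0 < a) (hB0 : 0 ≤ B) (hx : ∀ i ∈ S, a / 2 ≤ |x i|) (hB : ∀ i ∈ S, |x i| ≤ B)
    (hsp : ∀ i ∈ S, ∀ j ∈ S, i ≠ j → a ≤ |x i - x j|) :
    ∑ i ∈ S, |x i|⁻¹ ≤ 6 / a * (1 + Real.log (B / a + 1)) := by
  classical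
  rw [← Finset.sum_filter_add_sum_filter_not S (fun i => 0 ≤ x i)]
  have h1 := sum_inv_le_of_spaced_of_pos (S := S.filter fun i => 0 ≤ x i) (x := x) ha hB0
    (fun i hi => by
      rw [Finset.mem_filter] at hi
      simpa [abs_of_nonneg hi.2] using hx i hi.1)
    (fun i hi => (le_abs_self _).trans (hB i (Finset.mem_filter.1 hi).1))
    (fun i hi j hj => hsp i (Finset.mem_filter.1 hi).1 j (Finset.mem_filter.1 hj).1)
  have h2 := sum_inv_le_of_spaced_of_pos (S := S.filter fun i => ¬ 0 ≤ x i)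
    (x := fun i => -x i) ha hB0
    (fun i hi => by
      rw [Finset.mem_filter] at hi
      simpa [abs_of_neg (not_le.1 hi.2)] using hx i hi.1)
    (fun i hi => (neg_le_abs _).trans (hB i (Finset.mem_filter.1 hi).1))
    (fun i hi j hj hij => by
      rw [neg_sub_neg, abs_sub_comm]
      exact hsp i (Finset.mem_filter.1 hi).1 j (Finset.mem_filter.1 hj).1 hij)
  have e1 : ∑ i ∈ S.filter (fun i => 0 ≤ x i), |x i|⁻¹ =
      ∑ i ∈ S.filter (fun i => 0 ≤ x i), (x i)⁻¹ :=
    Finset.sum_congr rfl fun i hi => by rw [abs_of_nonneg (Finset.mem_filter.1 hi).2]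
  have e2 : ∑ i ∈ S.filter (fun i => ¬ 0 ≤ x i), |x i|⁻¹ =
      ∑ i ∈ S.filter (fun i => ¬ 0 ≤ x i), (-x i)⁻¹ :=
    Finset.sum_congr rfl fun i hi => by rw [abs_of_neg (not_le.1 (Finset.mem_filter.1 hi).2)]
  rw [e1, e2]
  calc _ ≤ _ := add_le_add h1 h2
    _ = _ := by ring

/-! ### ζ'/ζ near height t -/

/-- The partial fraction formula for `ζ'/ζ` near height `t`, when the zeros are simple and
spaced. -/
lemma exists_logDeriv_zeta_eq (hRH : RiemannHypothesis) {c T₀ : ℝ} (hc : 0 < c) (hc1 : c ≤ 1)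
    (hsimple : ∀ ρ : ℂ, riemannZeta ρ = 0 → T₀ ≤ ρ.im → deriv riemannZeta ρ ≠ 0)
    (hspaced : ∀ ρ ρ' : ℂ, riemannZeta ρ = 0 → riemannZeta ρ' = 0 → T₀ ≤ ρ.im → ρ.im < ρ'.im →
      c ≤ (ρ'.im - ρ.im) * Real.log ρ.im) :
    ∃ A : ℝ, 1 ≤ A ∧ ∀ᶠ t : ℝ in atTop, ∃ (Z : Finset ℂ) (h : ℂ → ℂ),
      (∀ z ∈ Z, z.re = 1 / 2 ∧ |t - z.im| ≤ 2) ∧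
      (∀ z ∈ Z, ∀ w ∈ Z, z ≠ w → c / (2 * Real.log t) ≤ |z.im - w.im|) ∧
      (∀ s ∈ Metric.closedBall (⟨2, t⟩ : ℂ) 1.6, riemannZeta s ≠ 0 →
        logDeriv riemannZeta s = ∑ z ∈ Z, (s - z)⁻¹ + h s) ∧
      (∀ s ∈ Metric.closedBall (⟨2, t⟩ : ℂ) 1.6, ‖h s‖ ≤ A * Real.log t) ∧
      ∀ s ∈ Metric.closedBall (⟨2, t⟩ : ℂ) 1.6, ∀ s' ∈ Metric.closedBall (⟨2, t⟩ : ℂ) 1.6,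
        ‖h s - h s'‖ ≤ A * Real.log t * ‖s - s'‖ := by
  -- The disc of radius 1.9 about `2 + it` reaches the line `Re s = 1/10`.
  obtain ⟨C, hC1, hC⟩ := exists_norm_zeta_le (σ := 1 / 10) (by norm_num)
  refine ⟨20000 * (29 / c), ?_, ?_⟩
  · have : 29 ≤ 29 / c := by
      rw [le_div_iff₀ hc]
      linarith
    linarith
  filter_upwards [eventually_ge_atTop 10, eventually_ge_atTop (T₀ + 2),
    eventually_ge_atTop (6 * C), Real.tendsto_log_atTop.eventually_ge_atTop 1] with t ht10 htT htC hL
  set p : ℂ := ⟨2, t⟩ with hp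
  set L := Real.log t with hLdef
  have hfin := (isCompact_closedBall p (1.8 : ℝ)).inter_riemannZetaZeros_finite
  set Z := hfin.toFinset with hZdef
  have hZ : ∀ z, z ∈ Z ↔ z ∈ Metric.closedBall p 1.8 ∧ riemannZeta z = 0 := fun z => by
    simp [hZdef, mem_riemannZetaZeros]
  have hball : ∀ {r : ℝ} {s : ℂ}, s ∈ Metric.closedBall p r →
      |s.re - 2| ≤ r ∧ |s.im - t| ≤ r := by
    intro r s hs
    rw [Metric.mem_closedBall, dist_eq_norm] at hs
    exact ⟨by simpa using (Complex.abs_re_le_norm (s - p)).trans hs,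
      by simpa using (Complex.abs_im_le_norm (s - p)).trans hs⟩
  have hZim : ∀ z ∈ Z, |z.im - t| ≤ 1.8 := fun z hz => (hball ((hZ z).1 hz).1).2
  have hZim2 : ∀ z ∈ Z, t - 1.8 ≤ z.im ∧ z.im ≤ t + 1.8 := fun z hz => by
    have := abs_le.1 (hZim z hz)
    exact ⟨by linarith [this.1], by linarith [this.2]⟩
  have hZre : ∀ z ∈ Z, z.re = 1 / 2 := fun z hz =>
    re_eq_half_of_zero hRH ((hZ z).1 hz).2 (by linarith [(hZim2 z hz).1])
  have hord : ∀ z ∈ Z, ∀ w ∈ Z, z.im < w.im → c / (2 * L) ≤ w.im - z.im := by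
    intro z hz w hw hlt
    have hz1 := hZim2 z hz
    have h1 := hspaced z w ((hZ z).1 hz).2 ((hZ w).1 hw).2 (by linarith [hz1.1]) hlt
    -- The crude bound `z.im ≤ t²` accounts for the 2 in the spacing `c/(2L)`.
    have h2 : Real.log z.im ≤ 2 * L := by
      have h3 : Real.log z.im ≤ Real.log (t ^ 2) :=
        Real.log_le_log (by linarith [hz1.1]) (by nlinarith [hz1.2])
      rw [Real.log_pow] at h3
      exact_mod_cast h3
    rw [div_le_iff₀ (by linarith)]
    exact h1.trans (mul_le_mul_of_nonneg_left h2 (by linarith))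
  have hsp : ∀ z ∈ Z, ∀ w ∈ Z, z ≠ w → c / (2 * L) ≤ |z.im - w.im| := by
    intro z hz w hw hne
    rcases lt_trichotomy z.im w.im with hlt | heq | hlt
    · rw [abs_sub_comm]
      exact (hord z hz w hw hlt).trans (le_abs_self _)
    · exact absurd (Complex.ext ((hZre z hz).trans (hZre w hw).symm) heq) hne
    · exact (hord w hw z hz hlt).trans (le_abs_self _)
  have hcard : (Z.card : ℝ) ≤ 9 * L / c := by
    have h1 := card_le_of_spaced (S := Z) (x := fun z => z.im - (t - 2)) (a := c / (2 * L))
      (B := 4) (by positivity) (by norm_num) (fun z hz => by linarith [(hZim2 z hz).1])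
      (fun z hz => by linarith [(hZim2 z hz).2])
      (fun z hz w hw hne => by simpa using hsp z hz w hw hne)
    have h2 : 4 / (c / (2 * L)) + 1 ≤ 9 * L / c := by
      rw [div_div_eq_mul_div, div_add_one hc.ne']
      gcongr
      linarith
    exact h1.trans h2
  have hbound : ∀ s ∈ Metric.closedBall p 1.9,
      ‖riemannZeta s‖ ≤ ‖riemannZeta p‖ * Real.exp (2 * L) := by
    intro s hs
    obtain ⟨h1, h2⟩ := hball hs
    rw [abs_le] at h1 h2
    have h3 := hC s (by linarith [h1.1]) (by linarith [h2.1])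
    have h4 : ‖s‖ ≤ 2 * t := by
      refine (Complex.norm_le_abs_re_add_abs_im s).trans ?_
      rw [abs_of_pos (by linarith [h1.1]), abs_of_pos (by linarith [h2.1])]
      linarith [h1.2, h2.2]
    have h5 := one_third_le_norm_zeta t
    have h6 : Real.exp (2 * L) = t ^ 2 := by
      rw [two_mul, Real.exp_add, hLdef, Real.exp_log (by linarith), sq]
    rw [h6]
    calc ‖riemannZeta s‖ ≤ C * (2 * t) := h3.trans (by gcongr)
      _ ≤ 1 / 3 * t ^ 2 := by nlinarith
      _ ≤ _ := by gcongr
  obtain ⟨h, hh1, hh2, hh3⟩ := logDeriv_eq_sum_add (f := riemannZeta) (c := p) (U := {1}ᶜ)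
    (M := 2 * L) isOpen_compl_singleton
    (fun s hs => ne_one_of_im_pos (by
      have := (abs_le.1 (hball hs).2).1
      linarith))
    differentiableOn_riemannZeta (by linarith) hbound Z hZ
    (fun z hz => hsimple z ((hZ z).1 hz).2 (by linarith [(hZim2 z hz).1]))
  -- Here `29 = 2 + 3 · 9`, with `c ≤ 1` used to put `2L` over `c`.
  have hA : 20000 * (2 * L + 3 * Z.card) ≤ 20000 * (29 / c) * L := by
    have h1 : 2 * L ≤ 2 * L / c := by
      rw [le_div_iff₀ hc]
      nlinarith
    calc 20000 * (2 * L + 3 * Z.card) ≤ 20000 * (2 * L / c + 3 * (9 * L / c)) := by gcongr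
      _ = _ := by ring
  refine ⟨Z, h, fun z hz => ⟨hZre z hz, ?_⟩, hsp, hh1, fun s hs => (hh2 s hs).trans hA,
    fun s hs s' hs' => (hh3 s hs s' hs').trans (by gcongr)⟩
  rw [abs_sub_comm]
  linarith [hZim z hz]

lemma exists_zeta_ne_zero_on_line {t η : ℝ} (hη : 0 < η) :
    ∃ t₁ : ℝ, t < t₁ ∧ t₁ < t + η ∧ riemannZeta ⟨1 / 2, t₁⟩ ≠ 0 := by
  by_contra hcon
  push Not at hcon
  have hK : IsCompact (Set.Icc (1 / 2 : ℝ) (1 / 2) ×ℂ Set.Icc t (t + η)) :=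
    isCompact_Icc.reProdIm isCompact_Icc
  have hfin := hK.inter_riemannZetaZeros_finite
  have hinf : (Set.Ioo t (t + η)).Infinite := Set.Ioo_infinite (by linarith)
  refine hinf ((hfin.image Complex.im).subset fun u hu => ?_)
  refine ⟨⟨1 / 2, u⟩, ⟨⟨?_, ?_⟩, hcon u hu.1 hu.2⟩, rfl⟩
  · simp
  · exact ⟨hu.1.le, hu.2.le⟩

/-! ### Zeros of ζ' keep away from the critical line -/

/-- If a critical point `s` lies close to the critical line and `∑ 1/(s - z)` over simple spaced
zeros `z` on that line has large real part, then `s` cannot be too close to the line. -/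
lemma re_lower_bound_of_sum {Z : Finset ℂ} {s : ℂ} {c A L ℓ ε δ : ℝ} (hc : 0 < c) (hA : 0 < A)
    (hL : 1 ≤ L) (hℓ : 1 ≤ ℓ) (hlog : 1 + Real.log (4 * L / c + 1) ≤ 3 * ℓ)
    (hδ : s.re - 1 / 2 = δ) (hδε : |δ| * L * ℓ ^ 2 ≤ ε)
    (hZ : ∀ z ∈ Z, z.re = 1 / 2 ∧ |s.im - z.im| ≤ 2)
    (hsp : ∀ z ∈ Z, ∀ w ∈ Z, z ≠ w → c / (2 * L) ≤ |z.im - w.im|)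
    (hnorm : ‖∑ z ∈ Z, (s - z)⁻¹‖ ≤ A * L) (hre : L / 16 ≤ (∑ z ∈ Z, (s - z)⁻¹).re)
    (hε1 : 144 * ε / c ^ 2 ≤ 1 / 32) :
    1 / 32 ≤ ε * (A + 36 / c) ^ 2 := by
  classical
  have hL0 : 0 < L := by linarith
  have hℓ0 : 0 < ℓ := by linarith
  have hne : Z.Nonempty := by
    by_contra h
    rw [Finset.not_nonempty_iff_eq_empty] at h
    simp only [h, Finset.sum_empty, Complex.zero_re] at hre
    linarith
  obtain ⟨ρ, hρ, hmin⟩ := Finset.exists_min_image Z (fun z => |s.im - z.im|) hne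
  set a := c / (2 * L) with ha
  have ha0 : 0 < a := by positivity
  -- Since `ρ` is nearest in height, a zero closer than `a/2` would force `ρ` within `a/2` too,
  -- against the spacing.
  have hfar : ∀ z ∈ Z.erase ρ, a / 2 ≤ |s.im - z.im| := by
    intro z hz
    obtain ⟨hzρ, hzZ⟩ := Finset.mem_erase.1 hz
    have h1 := hsp z hzZ ρ hρ hzρ
    have h2 := hmin z hzZ
    have h3 : |z.im - ρ.im| ≤ |s.im - z.im| + |s.im - ρ.im| := by
      rw [abs_sub_comm s.im z.im]
      exact abs_sub_le _ _ _
    linarith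
  have hsum : ∑ z ∈ Z.erase ρ, |s.im - z.im|⁻¹ ≤ 36 / c * (L * ℓ) := by
    have h1 := sum_inv_abs_le_of_spaced (S := Z.erase ρ) (x := fun z => s.im - z.im) (B := 2) ha0
      (by norm_num) hfar (fun z hz => (hZ z (Finset.mem_of_mem_erase hz)).2)
      (fun z hz w hw hzw => by
        rw [sub_sub_sub_cancel_left, abs_sub_comm]
        exact hsp z (Finset.mem_of_mem_erase hz) w (Finset.mem_of_mem_erase hw) hzw)
    have e1 : 2 / a = 4 * L / c := by
      rw [ha]
      field_simp
      norm_num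
    have e2 : 6 / a = 12 * L / c := by
      rw [ha]
      field_simp
      norm_num
    rw [e1, e2] at h1
    calc _ ≤ 12 * L / c * (3 * ℓ) := h1.trans (by gcongr)
      _ = _ := by ring
  have hfarpos : ∀ z ∈ Z.erase ρ, 0 < |s.im - z.im| := fun z hz =>
    (half_pos ha0).trans_le (hfar z hz)
  have him : ∀ z : ℂ, |s.im - z.im| ≤ ‖s - z‖ := fun z => by
    simpa using Complex.abs_im_le_norm (s - z)
  have hnz : ∀ z ∈ Z.erase ρ, ‖(s - z)⁻¹‖ ≤ |s.im - z.im|⁻¹ := fun z hz => by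
    rw [norm_inv]
    exact inv_anti₀ (hfarpos z hz) (him z)
  -- All `z` have real part `1/2`, so every term's real part carries the same factor `δ`.
  have hrez : ∀ z ∈ Z, ((s - z)⁻¹).re = δ * ‖(s - z)⁻¹‖ ^ 2 := fun z hz => by
    rw [Complex.inv_re, Complex.normSq_eq_norm_sq, Complex.sub_re, (hZ z hz).1, hδ, norm_inv,
      inv_pow, div_eq_mul_inv]
  have hrefar : ∑ z ∈ Z.erase ρ, ((s - z)⁻¹).re ≤ L / 32 := by
    have h1 : ∀ z ∈ Z.erase ρ, ((s - z)⁻¹).re ≤ |δ| * (2 / a) * |s.im - z.im|⁻¹ := by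
      intro z hz
      rw [hrez z (Finset.mem_of_mem_erase hz)]
      have h2 := hnz z hz
      have h3 : |s.im - z.im|⁻¹ ≤ 2 / a := by
        rw [← inv_div]
        exact inv_anti₀ (half_pos ha0) (hfar z hz)
      have h4 := (hfarpos z hz)
      calc δ * ‖(s - z)⁻¹‖ ^ 2 ≤ |δ| * ‖(s - z)⁻¹‖ ^ 2 := by
            gcongr
            exact le_abs_self δ
        _ ≤ |δ| * (|s.im - z.im|⁻¹ * |s.im - z.im|⁻¹) := by
            rw [sq]
            gcongr
        _ ≤ |δ| * (2 / a * |s.im - z.im|⁻¹) := by gcongr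
        _ = _ := by ring
    have h5 : |δ| * L * ℓ ≤ ε := by
      refine le_trans ?_ hδε
      have : ℓ ≤ ℓ ^ 2 := by nlinarith
      gcongr
    calc _ ≤ ∑ z ∈ Z.erase ρ, |δ| * (2 / a) * |s.im - z.im|⁻¹ := Finset.sum_le_sum h1
      _ = |δ| * (2 / a) * ∑ z ∈ Z.erase ρ, |s.im - z.im|⁻¹ := by rw [Finset.mul_sum]
      _ ≤ |δ| * (2 / a) * (36 / c * (L * ℓ)) := by gcongr
      _ = 144 * (|δ| * L * ℓ) / c ^ 2 * L := by
          rw [ha]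
          field_simp
          ring
      _ ≤ 144 * ε / c ^ 2 * L := by gcongr
      _ ≤ 1 / 32 * L := by gcongr
      _ = _ := by ring
  rw [← Finset.add_sum_erase Z _ hρ] at hnorm hre
  rw [Complex.add_re, Complex.re_sum] at hre
  -- The other zeros supply at most half of the required `L/16`, so `ρ` alone supplies the rest.
  have hw1 : L / 32 ≤ δ * ‖(s - ρ)⁻¹‖ ^ 2 := by
    rw [← hrez ρ hρ]
    linarith
  have hw2 : ‖(s - ρ)⁻¹‖ ≤ (A + 36 / c) * (L * ℓ) := by
    have h1 : ‖∑ z ∈ Z.erase ρ, (s - z)⁻¹‖ ≤ 36 / c * (L * ℓ) :=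
      (norm_sum_le_of_le _ hnz).trans hsum
    have h2 := norm_le_add_norm_add (s - ρ)⁻¹ (∑ z ∈ Z.erase ρ, (s - z)⁻¹)
    have h3 : A * L ≤ A * (L * ℓ) := by
      gcongr
      exact le_mul_of_one_le_right hL0.le hℓ
    linarith
  have hfinal : L / 32 ≤ ε * (A + 36 / c) ^ 2 * L := by
    calc L / 32 ≤ δ * ‖(s - ρ)⁻¹‖ ^ 2 := hw1
      _ ≤ |δ| * ((A + 36 / c) * (L * ℓ)) ^ 2 := by
          gcongr
          exact le_abs_self δ
      _ = |δ| * L * ℓ ^ 2 * ((A + 36 / c) ^ 2 * L) := by ring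
      _ ≤ ε * ((A + 36 / c) ^ 2 * L) := by gcongr
      _ = _ := by ring
  have h1 : 1 / 32 * L ≤ ε * (A + 36 / c) ^ 2 * L := by linarith
  exact le_of_mul_le_mul_right h1 hL0

/-- If the zeros of `ζ` are simple and spaced, the zeros of `ζ'` stay away from the critical
line. -/
theorem exists_lower_bound_deriv_zeros (hRH : RiemannHypothesis) {c T₀ : ℝ} (hc : 0 < c)
    (hc1 : c ≤ 1)
    (hsimple : ∀ ρ : ℂ, riemannZeta ρ = 0 → T₀ ≤ ρ.im → deriv riemannZeta ρ ≠ 0)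
    (hspaced : ∀ ρ ρ' : ℂ, riemannZeta ρ = 0 → riemannZeta ρ' = 0 → T₀ ≤ ρ.im → ρ.im < ρ'.im →
      c ≤ (ρ'.im - ρ.im) * Real.log ρ.im) :
    ∃ ε : ℝ, 0 < ε ∧ ∀ᶠ t : ℝ in atTop, ∀ s : ℂ, s.im = t → deriv riemannZeta s = 0 →
      ε ≤ |s.re - 1 / 2| * Real.log t * Real.log (Real.log t) ^ 2 := by
  obtain ⟨A, hA1, hA⟩ := exists_logDeriv_zeta_eq hRH hc hc1 hsimple hspaced
  obtain ⟨T, -, hT⟩ := exists_re_logDeriv_zeta_le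
  have hA0 : 0 < A := by linarith
  set D := A + 36 / c with hD
  have hD0 : 0 < D := by positivity
  -- The three bounds keep `s` near the line, make the distant zeros negligible (`4608 = 144 · 32`),
  -- and give `ε D² ≤ 1/33 < 1/32` for the final contradiction.
  set ε := min (1 / (32 * A)) (min (c ^ 2 / 4608) (1 / (33 * D ^ 2))) with hε
  have hε0 : 0 < ε := by positivity
  have hεA : ε ≤ 1 / (32 * A) := min_le_left _ _
  have hεc : ε ≤ c ^ 2 / 4608 := (min_le_right _ _).trans (min_le_left _ _)
  have hεD : ε ≤ 1 / (33 * D ^ 2) := (min_le_right _ _).trans (min_le_right _ _)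
  have hA32 : 1 / (32 * A) ≤ 1 / 32 := by
    apply one_div_le_one_div_of_le <;> linarith
  refine ⟨ε, hε0, ?_⟩
  filter_upwards [hA, eventually_ge_atTop T, eventually_ge_atTop T₀, eventually_ge_atTop 1,
    Real.tendsto_log_atTop.eventually_ge_atTop (max 1 (5 / c)),
    (Real.tendsto_log_atTop.comp Real.tendsto_log_atTop).eventually_ge_atTop 1]
    with t hAt hTt hT0t ht1 hLmax hℓ s hst hds
  obtain ⟨Z, h, hZ, hsp, hsum, hh, hlip⟩ := hAt
  have hL1 : 1 ≤ Real.log t := (le_max_left _ _).trans hLmax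
  have hL5 : 5 / c ≤ Real.log t := (le_max_right _ _).trans hLmax
  simp only [Function.comp_apply] at hℓ
  set L := Real.log t with hLdef
  set ℓ := Real.log L with hℓdef
  by_contra hcon
  rw [not_le] at hcon
  set δ := s.re - 1 / 2 with hδ
  have hδs : |δ| ≤ 1 / (32 * A) := by
    have h1 : |δ| * 1 * 1 ≤ |δ| * L * ℓ ^ 2 := by
      gcongr
      nlinarith
    linarith
  have hs0 : riemannZeta s ≠ 0 := fun h0 => hsimple s h0 (by linarith) hds
  have hsball : s ∈ Metric.closedBall (⟨2, t⟩ : ℂ) 1.6 := by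
    rw [Metric.mem_closedBall, dist_eq_norm]
    refine (Complex.norm_le_abs_re_add_abs_im _).trans ?_
    simp only [Complex.sub_re, Complex.sub_im, hst, sub_self, abs_zero, add_zero]
    rw [abs_le] at hδs ⊢
    constructor <;> norm_num <;> linarith [hδs.1, hδs.2]
  -- ζ may vanish at `1/2 + it` itself, so the comparison point on the line is moved up slightly.
  obtain ⟨t₁, ht1l, ht1r, hz1⟩ := exists_zeta_ne_zero_on_line (t := t) (η := 1 / (32 * A))
    (by positivity)
  set s₁ : ℂ := ⟨1 / 2, t₁⟩ with hs1
  have hs1ball : s₁ ∈ Metric.closedBall (⟨2, t⟩ : ℂ) 1.6 := by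
    rw [Metric.mem_closedBall, dist_eq_norm]
    refine (Complex.norm_le_abs_re_add_abs_im _).trans ?_
    simp only [hs1, Complex.sub_re, Complex.sub_im]
    rw [abs_of_pos (by linarith : 0 < t₁ - t)]
    norm_num [abs_of_neg]
    linarith
  have hh1 : (h s₁).re ≤ -(L / 8) := by
    have h1 := hT t₁ (by linarith) hz1
    rw [hsum s₁ hs1ball hz1, Complex.add_re, Complex.re_sum] at h1
    have h2 : ∑ z ∈ Z, ((s₁ - z)⁻¹).re = 0 := Finset.sum_eq_zero fun z hz => by
      rw [Complex.inv_re, Complex.sub_re, (hZ z hz).1, hs1]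
      simp
    have h3 : L ≤ Real.log t₁ := Real.log_le_log (by linarith) ht1l.le
    linarith
  have hdist : ‖s - s₁‖ ≤ 1 / (16 * A) := by
    refine (Complex.norm_le_abs_re_add_abs_im _).trans ?_
    simp only [hs1, Complex.sub_re, Complex.sub_im, hst, ← hδ]
    rw [abs_sub_comm t t₁, abs_of_pos (by linarith : 0 < t₁ - t)]
    have : 1 / (16 * A) = 1 / (32 * A) + 1 / (32 * A) := by
      field_simp
      norm_num
    linarith
  -- The Lipschitz bound over a distance `1/(16A)` loses at most `L/16` of the `L/8`.
  have hh2 : (h s).re ≤ -(L / 16) := by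
    have h1 := (Complex.abs_re_le_norm _).trans (hlip s hsball s₁ hs1ball)
    have h2 : A * L * ‖s - s₁‖ ≤ L / 16 := by
      calc A * L * ‖s - s₁‖ ≤ A * L * (1 / (16 * A)) := by gcongr
        _ = _ := by
          field_simp
    rw [Complex.sub_re] at h1
    linarith [le_abs_self ((h s).re - (h s₁).re)]
  have hzero := hsum s hsball hs0
  rw [logDeriv_apply, hds, zero_div] at hzero
  have hS : ∑ z ∈ Z, (s - z)⁻¹ = -h s := by linear_combination -hzero
  -- `L ≥ 5/c` gives `4L/c + 1 ≤ L²`, whose logarithm is `2ℓ`; the remaining 1 is at most `ℓ`.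
  have hlog : 1 + Real.log (4 * L / c + 1) ≤ 3 * ℓ := by
    have h1 : 4 * L / c + 1 ≤ L ^ 2 := by
      have h2 : 1 ≤ L / c := by
        rw [le_div_iff₀ hc]
        linarith
      calc 4 * L / c + 1 ≤ 4 * L / c + L / c := by linarith
        _ = L * (5 / c) := by ring
        _ ≤ L * L := by gcongr
        _ = _ := by ring
    have h3 := Real.log_le_log (by positivity) h1
    rw [Real.log_pow] at h3
    push_cast at h3
    linarith
  have hbig := re_lower_bound_of_sum (Z := Z) (s := s) (δ := δ) (ε := ε) (A := A) hc hA0 hL1 hℓ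
    hlog rfl hcon.le (fun z hz => by rw [hst]; exact hZ z hz) hsp
    (by rw [hS, norm_neg]; exact hh s hsball) (by rw [hS, Complex.neg_re]; linarith)
    (by
      rw [div_le_iff₀ (by positivity)]
      linarith)
  have h1 : ε * D ^ 2 ≤ 1 / 33 := by
    calc ε * D ^ 2 ≤ 1 / (33 * D ^ 2) * D ^ 2 := by gcongr
      _ = _ := by field_simp
  linarith

/-! ### Conclusion -/

/-- The lower limits are taken in the extended reals. -/
theorem theorem3
    (hRH : RiemannHypothesis)
    (h : liminf (fun ρ' : ℂ =>
        (((ρ'.re - 1 / 2) * Real.log ρ'.im * Real.log (Real.log ρ'.im) ^ 2 : ℝ) : EReal))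
      zetaDerivZerosAtTop = 0) :
    liminf (fun n : ℕ =>
        (((zetaOrdinate (n + 1) - zetaOrdinate n) * Real.log (zetaOrdinate n) : ℝ) : EReal))
      atTop = 0 := by
  refine le_antisymm ?_ ?_
  · by_contra hpos
    rw [not_le] at hpos
    obtain ⟨c', hc'0, hc'⟩ := EReal.lt_iff_exists_real_btwn.1 hpos
    have hc'pos : 0 < c' := by exact_mod_cast hc'0
    have hev : ∀ᶠ n : ℕ in atTop,
        min c' 1 ≤ (zetaOrdinate (n + 1) - zetaOrdinate n) * Real.log (zetaOrdinate n) := by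
      filter_upwards [eventually_lt_of_lt_liminf hc'] with n hn
      exact (min_le_left _ _).trans (by exact_mod_cast hn.le)
    have hc0 : 0 < min c' 1 := by positivity
    obtain ⟨T₀, -, hsimple, hspaced⟩ := zeros_simple_and_spaced hRH hc0 hev
    obtain ⟨ε, hε, hlow⟩ :=
      exists_lower_bound_deriv_zeros hRH hc0 (min_le_right _ _) hsimple hspaced
    have hlowev : ∀ᶠ s in zetaDerivZerosAtTop,
        ε ≤ |s.re - 1 / 2| * Real.log s.im * Real.log (Real.log s.im) ^ 2 := by
      rw [zetaDerivZerosAtTop, eventually_inf_principal]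
      filter_upwards [hlow.comap Complex.im] with s hs hds using hs s rfl hds
    have hlogpos : ∀ᶠ s in zetaDerivZerosAtTop, 0 ≤ Real.log s.im := by
      rw [zetaDerivZerosAtTop, eventually_inf_principal]
      filter_upwards [(Real.tendsto_log_atTop.eventually_ge_atTop 0).comap Complex.im]
        with s hs _ using hs
    have hfreq := frequently_lt_of_liminf_lt (f := zetaDerivZerosAtTop) (b := (ε : EReal))
      (u := fun ρ' : ℂ =>
        (((ρ'.re - 1 / 2) * Real.log ρ'.im * Real.log (Real.log ρ'.im) ^ 2 : ℝ) : EReal))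
      (h := by
        rw [h]
        exact_mod_cast hε)
    -- The lower bound for zeros of ζ' is on `|β' - 1/2|`. The hypothesis that the lower limit
    -- equals 0, rather than being at most 0, also keeps the expression above `-ε`, so no
    -- information on the sign of `β' - 1/2` is needed.
    have hgt := eventually_lt_of_lt_liminf (f := zetaDerivZerosAtTop) (b := ((-ε : ℝ) : EReal))
      (u := fun ρ' : ℂ =>
        (((ρ'.re - 1 / 2) * Real.log ρ'.im * Real.log (Real.log ρ'.im) ^ 2 : ℝ) : EReal))
      (by
        rw [h]
        exact_mod_cast neg_neg_of_pos hε)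
    obtain ⟨s, hs1, hs2, hs3, hs4⟩ := (hfreq.and_eventually (hgt.and (hlowev.and hlogpos))).exists
    have h1 := EReal.coe_lt_coe_iff.1 hs1
    have h2 := EReal.coe_lt_coe_iff.1 hs2
    have h3 : |(s.re - 1 / 2) * Real.log s.im * Real.log (Real.log s.im) ^ 2| < ε :=
      abs_lt.2 ⟨h2, h1⟩
    rw [abs_mul, abs_mul, abs_of_nonneg hs4,
      abs_of_nonneg (sq_nonneg (Real.log (Real.log s.im)))] at h3
    linarith
  · refine le_liminf_of_le (by isBoundedDefault) ?_
    filter_upwards [eventually_gap_nonneg hRH] with n hn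
    exact_mod_cast hn
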